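/- Let $\mathbb N=\{1,2,3,\dots\}$, and let $G=(V,E)$ be a finite simple graph that is chordal (every cycle of length at least $4$ has a chord), has at least $2$ vertices and has at least one edge. For $I\subseteq\mathbb R$ let $\mathbb P_G(I)$ be the set of symmetric positive semidefinite real matrices $A=(a_{ij})_{i,j\in V}$ with all entries in $I$ and with $a_{ij}=0$ whenever $i\neq j$ and $\{i,j\}\notin E$; write $\mathbb P_G=\mathbb P_G(\mathbb R)$. For $\alpha\in\mathbb R$ put $\psi_\alpha(x)=\operatorname{sgn}(x)|x|^\alpha$ and $\phi_\alpha(x)=|x|^\alpha$ for $x\neq 0$, $\psi_\alpha(0)=\phi_\alpha(0)=0$, and $0^\alpha=0$. For a function $f$ let $f[A]=(f(a_{ij}))$, and for $A$ with nonnegative entries let $A^{\circ\alpha}=(a_{ij}^\alpha)$. Define $$\mathcal H_G=\{\alpha\in\mathbb R: A^{\circ\alpha}\in\mathbb P_G\ \text{for all } A\in\mathbb P_G([0,\infty))\},$$ $$\mathcal H_G^\psi=\{\alpha\in\mathbb R:\psi_\alpha[A]\in\mathbb P_G\ \text{for all } A\in\mathbb P_G\},\qquad \mathcal H_G^\phi=\{\alpha\in\mathbb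 R:\phi_\alpha[A]\in\mathbb P_G\ \text{for all } A\in\mathbb P_G\}.$$ Let $CE_H(G)$, $CE_H^\psi(G)$, $CE_H^\phi(G)$ be the smallest $\alpha\in\mathbb R$ such that every $\beta\ge\alpha$ belongs to $\mathcal H_G$, $\mathcal H_G^\psi$, $\mathcal H_G^\phi$, respectively. Let $r$ be the largest integer such that $K_r^{(1)}$, the complete graph on $r$ vertices with one edge removed, is a (not necessarily induced) subgraph of $G$. Then $$\mathcal H_G=\mathbb N\cup[r-2,\infty),\qquad \mathcal H_G^\psi=(-1+2\mathbb N)\cup[r-2,\infty),\qquad \mathcal H_G^\phi=2\mathbb N\cup[r-2,\infty).$$ In particular, the minima defining the three critical exponents exist and $CE_H(G)=CE_H^\psi(G)=CE_H^\phi(G)=r-2$. -/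

import Mathlib

/-- A graph is chordal if every cycle of length at least four has a chord: an edge of the graph
joining two vertices of the cycle that is not itself an edge of the cycle. -/
def SimpleGraph.IsChordal {V : Type*} (G : SimpleGraph V) : Prop :=
  ∀ (w : V) (c : G.Walk w w), c.IsCycle → 4 ≤ c.length →
    ∃ u ∈ c.support, ∃ v ∈ c.support, G.Adj u v ∧ s(u, v) ∉ c.edges

/-- The complete graph on the `k` vertices `0, …, k - 1` with the edge `{0, 1}` removed
(two distinct natural numbers have sum `1` exactly when they are `0` and `1`).
It is the graph `K_k^{(1)}` for every `k ≥ 2`. -/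
def completeMinusEdge (k : ℕ) : SimpleGraph (Fin k) where
  Adj i j := i ≠ j ∧ (i : ℕ) + (j : ℕ) ≠ 1
  symm := ⟨fun i j h => ⟨h.1.symm, by rw [add_comm]; exact h.2⟩⟩
  loopless := ⟨fun _ h => h.1 rfl⟩

/-- The cone `P_G(I)`: symmetric positive semidefinite real matrices, indexed by the vertices
of `G`, with entries in `I`, whose off-diagonal entries vanish at every non-edge of `G`. -/
def graphCone {V : Type*} (G : SimpleGraph V) (I : Set ℝ) : Set (Matrix V V ℝ) :=
  {A | A.PosSemidef ∧ (∀ i j, A i j ∈ I) ∧ ∀ i j, i ≠ j → ¬ G.Adj i j → A i j = 0}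

/-- The power `x ^ α` for `x ≥ 0`, with the convention `0 ^ α = 0` for every `α`. -/
noncomputable def posPower (α x : ℝ) : ℝ := if x = 0 then 0 else x ^ α

/-- The odd extension `ψ_α` of the power function, with `ψ_α 0 = 0`. -/
noncomputable def oddPower (α x : ℝ) : ℝ := if x = 0 then 0 else Real.sign x * |x| ^ α

/-- The even extension `φ_α` of the power function, with `φ_α 0 = 0`. -/
noncomputable def evenPower (α x : ℝ) : ℝ := if x = 0 then 0 else |x| ^ α

/-- `H_G`. -/
def powerSet {V : Type*} (G : SimpleGraph V) : Set ℝ :=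
  {α | ∀ A ∈ graphCone G (Set.Ici 0), A.map (posPower α) ∈ graphCone G Set.univ}

/-- `H_G^ψ`. -/
def oddPowerSet {V : Type*} (G : SimpleGraph V) : Set ℝ :=
  {α | ∀ A ∈ graphCone G Set.univ, A.map (oddPower α) ∈ graphCone G Set.univ}

/-- `H_G^φ`. -/
def evenPowerSet {V : Type*} (G : SimpleGraph V) : Set ℝ :=
  {α | ∀ A ∈ graphCone G Set.univ, A.map (evenPower α) ∈ graphCone G Set.univ}

/-- `c = CE_H(G)`: the minimum exists and is equal to `c`. -/
def IsCriticalExponent {V : Type*} (G : SimpleGraph V) (c : ℝ) : Prop :=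
  IsLeast {α : ℝ | ∀ A ∈ graphCone G (Set.Ici 0), ∀ β, α ≤ β →
    A.map (posPower β) ∈ graphCone G Set.univ} c

/-- `c = CE_H^ψ(G)`: the minimum exists and is equal to `c`. -/
def IsOddCriticalExponent {V : Type*} (G : SimpleGraph V) (c : ℝ) : Prop :=
  IsLeast {α : ℝ | ∀ A ∈ graphCone G Set.univ, ∀ β, α ≤ β →
    A.map (oddPower β) ∈ graphCone G Set.univ} c

/-- `c = CE_H^φ(G)`: the minimum exists and is equal to `c`. -/
def IsEvenCriticalExponent {V : Type*} (G : SimpleGraph V) (c : ℝ) : Prop :=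
  IsLeast {α : ℝ | ∀ A ∈ graphCone G Set.univ, ∀ β, α ≤ β →
    A.map (evenPower β) ∈ graphCone G Set.univ} c

/-!
Write `f` for `ψ_α` or `φ_α`. Both restrict to `x ^ α` on `[0, ∞)`, and differentiation turns one
into `α` times the other with exponent `α - 1`, so they are treated together as `signedPower`.

**Powers `α ≥ r - 2` work.** By induction on the number of vertices, three properties of `f` on
positive semidefinite matrices over `n` vertices are obtained together: `f` preserves positivity if
`α ≥ n - 2`, is monotone in the Loewner order if `α ≥ n - 1`, and is superadditive if `α ≥ n`.
Monotonicity follows from positivity for the derivative, and superadditivity from monotonicity of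
the derivative, by integrating along a segment and using the Schur product theorem. Positivity for
`n + 1` vertices follows from monotonicity for `n` vertices: `A` is the sum of a rank-one matrix,
to which `f` applies multiplicatively, and a matrix on `n` vertices (`posSemidef_map_signedPower`,
`posSemidef_signedPower_superadditive`).

For a chordal graph that is not complete, take a clique `C` that separates two parts, each of which
contains a vertex joined to all of `C`
(`SimpleGraph.IsChordal.exists_full_isCliqueSeparation`). Then `K_{|C| + 2}^{(1)}` is a subgraph, so
`|C| ≤ r - 2 ≤ α`. Gaussian elimination of one part writes `A = A₁ + A₂` with supports overlapping
in `C` only, and by superadditivity `f[A] - f[A₁] - f[A₂]` is positive semidefinite; recurse on both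
parts. The recursion ends at cliques, where `n ≤ r` because `K_n^{(1)}` is a subgraph of `K_n`.

**Other powers fail.** Positive integers of the right parity work by the Schur product theorem, and
negative powers fail on an edge. Let `0 ≤ α < m + 1 ≤ r - 2`, and glue the rank-one matrices
`(1, u)(1, u)ᵀ` and `(1, v)(1, v)ᵀ` along a clique of `m + 1` vertices, where `u = (1, …, 1)` and
`v = √ε x`. The Schur complement of the two remaining vertices is the matrix with entries
`f(1 + ε xᵢ xⱼ) - 1 - ε ^ α f(xᵢ) f(xⱼ)`. On a vector `y` orthogonal to `x, x², …, x ^ m` its form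
is `O(ε ^ (m + 1)) - ε ^ α (∑ yᵢ f(xᵢ))²`, which is negative for small `ε` if `y` is not orthogonal
to `f[x]`. Such `x` and `y` come from Lagrange interpolation of `f` at `0, …, m`, whenever `f` differs
from its interpolant somewhere: on `(0, ∞)` if `α` is not a positive integer
(`eq_natCast_or_le_of_mem_powerSet`), and at `-1` if `α = m` has the wrong parity
(`le_of_natCast_mem_signedPowerSet`).
-/

/-! ### Odd and even powers on the real line -/

/-- The odd extension `ψ_α` (for `odd = true`) or the even extension `φ_α` (for `odd = false`)
of the power function. Differentiation exchanges the two. -/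
noncomputable def signedPower (odd : Bool) (α x : ℝ) : ℝ :=
  cond odd (oddPower α x) (evenPower α x)

/-- The value of `signedPower odd α` at `-1`. -/
def paritySign (odd : Bool) : ℝ := cond odd (-1) 1

@[simp] lemma paritySign_not (odd : Bool) : paritySign (!odd) = -paritySign odd := by
  cases odd <;> simp [paritySign]

@[simp] lemma signedPower_zero (odd : Bool) (α : ℝ) : signedPower odd α 0 = 0 := by
  cases odd <;> simp [signedPower, oddPower, evenPower]

lemma signedPower_of_pos (odd : Bool) (α : ℝ) {x : ℝ} (hx : 0 < x) :
    signedPower odd α x = x ^ α := by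
  cases odd <;> simp [signedPower, oddPower, evenPower, hx.ne', abs_of_pos hx, Real.sign_of_pos hx]

lemma signedPower_of_neg (odd : Bool) (α : ℝ) {x : ℝ} (hx : x < 0) :
    signedPower odd α x = paritySign odd * (-x) ^ α := by
  cases odd <;> simp [signedPower, oddPower, evenPower, paritySign, hx.ne, abs_of_neg hx,
    Real.sign_of_neg hx]

lemma signedPower_of_nonneg (odd : Bool) (α : ℝ) {x : ℝ} (hx : 0 ≤ x) :
    signedPower odd α x = posPower α x := by
  rcases hx.eq_or_lt with rfl | hx
  · simp [posPower]
  · simp [signedPower_of_pos odd α hx, posPower, hx.ne']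

lemma signedPower_one (odd : Bool) (α : ℝ) : signedPower odd α 1 = 1 := by
  simp [signedPower_of_pos]

lemma signedPower_mul (odd : Bool) (α x y : ℝ) :
    signedPower odd α (x * y) = signedPower odd α x * signedPower odd α y := by
  have hs : paritySign odd * paritySign odd = 1 := by cases odd <;> simp [paritySign]
  rcases lt_trichotomy x 0 with hx | rfl | hx
  · rcases lt_trichotomy y 0 with hy | rfl | hy
    · rw [signedPower_of_pos _ _ (mul_pos_of_neg_of_neg hx hy), signedPower_of_neg _ _ hx,
        signedPower_of_neg _ _ hy, ← neg_mul_neg, Real.mul_rpow (by linarith) (by linarith)]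
      linear_combination -(-x) ^ α * (-y) ^ α * hs
    · simp
    · rw [signedPower_of_neg _ _ (mul_neg_of_neg_of_pos hx hy), signedPower_of_neg _ _ hx,
        signedPower_of_pos _ _ hy, ← neg_mul, Real.mul_rpow (by linarith) hy.le, mul_assoc]
  · simp
  · rcases lt_trichotomy y 0 with hy | rfl | hy
    · rw [signedPower_of_neg _ _ (mul_neg_of_pos_of_neg hx hy), signedPower_of_pos _ _ hx,
        signedPower_of_neg _ _ hy, ← mul_neg, Real.mul_rpow hx.le (by linarith)]
      ring
    · simp
    · rw [signedPower_of_pos _ _ (mul_pos hx hy), signedPower_of_pos _ _ hx,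
        signedPower_of_pos _ _ hy, Real.mul_rpow hx.le hy.le]

lemma abs_signedPower_le (odd : Bool) {γ x C : ℝ} (hγ : 0 ≤ γ) (hx : |x| ≤ C) :
    |signedPower odd γ x| ≤ C ^ γ := by
  have hC : 0 ≤ C := (abs_nonneg x).trans hx
  have hs : |paritySign odd| = 1 := by cases odd <;> simp [paritySign]
  have key : |x| ^ γ ≤ C ^ γ := Real.rpow_le_rpow (abs_nonneg x) hx hγ
  rcases lt_trichotomy x 0 with h | rfl | h
  · rw [signedPower_of_neg _ _ h, abs_mul, hs, one_mul, ← abs_of_neg h,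
      abs_of_nonneg (Real.rpow_nonneg (abs_nonneg x) γ)]
    exact key
  · simpa using Real.rpow_nonneg hC γ
  · rw [signedPower_of_pos _ _ h, abs_of_nonneg (Real.rpow_nonneg h.le γ)]
    rwa [abs_of_pos h] at key

lemma measurable_signedPower (odd : Bool) (γ : ℝ) : Measurable (signedPower odd γ) := by
  have h : signedPower odd γ =
      fun x => if x < 0 then paritySign odd * (-x) ^ γ else if x = 0 then 0 else x ^ γ := by
    funext x
    rcases lt_trichotomy x 0 with h | rfl | h
    · simp [signedPower_of_neg _ _ h, h]
    · simp
    · simp [signedPower_of_pos _ _ h, h.ne', h.not_gt]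
  rw [h]
  refine Measurable.ite (measurableSet_lt measurable_id measurable_const) (by fun_prop) ?_
  exact Measurable.ite (measurableSet_eq_fun measurable_id measurable_const) (by fun_prop)
    (by fun_prop)

lemma continuous_signedPower (odd : Bool) {γ : ℝ} (hγ : 0 < γ) :
    Continuous (signedPower odd γ) := by
  have h : signedPower odd γ =
      fun x => if x ≤ 0 then paritySign odd * (-x) ^ γ else x ^ γ := by
    funext x
    rcases lt_trichotomy x 0 with h | rfl | h
    · simp [signedPower_of_neg _ _ h, h.le]
    · simp [hγ.ne']
    · simp [signedPower_of_pos _ _ h, h]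
  rw [h]
  have h1 : Continuous fun x : ℝ => x ^ γ := continuous_id.rpow_const fun _ => Or.inr hγ.le
  refine Continuous.if_le (continuous_const.mul (h1.comp continuous_neg)) h1 continuous_id
    continuous_const ?_
  rintro x rfl
  simp [hγ.ne']

lemma hasDerivAt_signedPower (odd : Bool) (β : ℝ) {x : ℝ} (hx : x ≠ 0) :
    HasDerivAt (signedPower odd β) (β * signedPower (!odd) (β - 1) x) x := by
  rcases lt_or_gt_of_ne hx with h | h
  · have h1 : HasDerivAt (fun y : ℝ => paritySign odd * (-y) ^ β)
        (β * signedPower (!odd) (β - 1) x) x := by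
      have := (((hasDerivAt_id x).neg).rpow_const (p := β) (Or.inl (by simpa using hx))).const_mul
        (paritySign odd)
      refine this.congr_deriv ?_
      rw [signedPower_of_neg _ _ h, paritySign_not]
      simp
      ring
    refine h1.congr_of_eventuallyEq ?_
    filter_upwards [Iio_mem_nhds h] with y hy using signedPower_of_neg _ _ hy
  · have h1 : HasDerivAt (fun y : ℝ => y ^ β) (β * signedPower (!odd) (β - 1) x) x := by
      rw [signedPower_of_pos _ _ h]
      exact Real.hasDerivAt_rpow_const (Or.inl hx)
    refine h1.congr_of_eventuallyEq ?_
    filter_upwards [Ioi_mem_nhds h] with y hy using signedPower_of_pos _ _ hy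

open MeasureTheory in
lemma intervalIntegrable_signedPower_segment (odd : Bool) {γ : ℝ} (hγ : 0 ≤ γ) (a b : ℝ) :
    IntervalIntegrable (fun t => signedPower odd γ (a + t * b)) volume 0 1 := by
  rw [intervalIntegrable_iff_integrableOn_Ioc_of_le zero_le_one]
  refine Measure.integrableOn_of_bounded (M := (|a| + |b|) ^ γ) (by simp) ?_ ?_
  · exact ((measurable_signedPower odd γ).comp (by fun_prop)).aestronglyMeasurable
  · refine (ae_restrict_iff' measurableSet_Ioc).mpr (Filter.Eventually.of_forall fun t ht => ?_)
    refine abs_signedPower_le odd hγ ((abs_add_le _ _).trans ?_)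
    rw [abs_mul, abs_of_pos ht.1]
    nlinarith [abs_nonneg b, ht.2]

open MeasureTheory in
/-- The fundamental theorem of calculus for `signedPower` along a segment. The derivative may fail
to exist at the one point where the segment crosses `0` (as for `|x|` when `β = 1`). -/
lemma integral_signedPower_segment (odd : Bool) {β : ℝ} (hβ : 1 ≤ β) (a b : ℝ) :
    ∫ t in (0 : ℝ)..1, b * (β * signedPower (!odd) (β - 1) (a + t * b)) =
      signedPower odd β (a + b) - signedPower odd β a := by
  have hs : {t : ℝ | b ≠ 0 ∧ a + t * b = 0}.Countable := by
    refine Set.Subsingleton.countable ?_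
    rintro t ⟨hb, ht⟩ t' ⟨-, ht'⟩
    exact mul_right_cancel₀ hb (by linarith)
  have h := integral_eq_of_hasDerivAt_off_countable_of_le
    (fun t => signedPower odd β (a + t * b))
    (fun t => b * (β * signedPower (!odd) (β - 1) (a + t * b))) zero_le_one hs
    ((continuous_signedPower odd (by linarith)).comp (by fun_prop)).continuousOn ?_
    (((intervalIntegrable_signedPower_segment (!odd) (by linarith) a b).const_mul β).const_mul b)
  · simpa using h
  · rintro t ⟨-, ht⟩
    by_cases hb : b = 0
    · subst hb
      simpa using hasDerivAt_const t (signedPower odd β a)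
    · have hne : a + t * b ≠ 0 := fun h0 => ht ⟨hb, h0⟩
      have h2 : HasDerivAt (fun t : ℝ => a + t * b) b t := by
        simpa using ((hasDerivAt_id t).mul_const b).const_add a
      have := (hasDerivAt_signedPower odd β hne).comp t h2
      rwa [mul_comm] at this

/-! ### Positive semidefinite matrices -/

section
variable {V : Type*} [Fintype V]

lemma posSemidef_iff_sum_nonneg {A : Matrix V V ℝ} :
    A.PosSemidef ↔ (∀ i j, A i j = A j i) ∧ ∀ x : V → ℝ, 0 ≤ ∑ i, ∑ j, x i * A i j * x j := by
  rw [Matrix.posSemidef_iff_dotProduct_mulVec]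
  refine and_congr ⟨fun h i j => ?_, fun h => ?_⟩ (forall_congr' fun x => ?_)
  · simpa using (h.apply i j).symm
  · ext i j
    simpa using h j i
  · simp only [dotProduct, Matrix.mulVec, Finset.mul_sum, star_trivial, mul_assoc]

lemma Matrix.PosSemidef.apply_comm {W : Type*} {A : Matrix W W ℝ} (hA : A.PosSemidef) (i j : W) :
    A i j = A j i := by
  simpa using (hA.isHermitian.apply i j).symm

lemma posSemidef_vecMulVec_self {W : Type*} [Finite W] (u : W → ℝ) :
    (Matrix.vecMulVec u u).PosSemidef := by
  simpa using Matrix.posSemidef_vecMulVec_self_star u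

open Classical in
/-- The matrix `A` with every entry outside `s × s` replaced by `0`. -/
noncomputable def Matrix.restrictTo {W : Type*} (A : Matrix W W ℝ) (s : Finset W) : Matrix W W ℝ :=
  Matrix.of fun i j => if i ∈ s ∧ j ∈ s then A i j else 0

lemma Matrix.restrictTo_apply_of_mem {W : Type*} (A : Matrix W W ℝ) {s : Finset W} {i j : W}
    (hi : i ∈ s) (hj : j ∈ s) : A.restrictTo s i j = A i j := by
  simp [Matrix.restrictTo, hi, hj]

lemma Matrix.restrictTo_apply_of_notMem_left {W : Type*} (A : Matrix W W ℝ) {s : Finset W} {i : W}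
    (hi : i ∉ s) (j : W) : A.restrictTo s i j = 0 := by
  simp [Matrix.restrictTo, hi]

lemma Matrix.PosSemidef.restrictTo {A : Matrix V V ℝ} (hA : A.PosSemidef) (s : Finset V) :
    (A.restrictTo s).PosSemidef := by
  classical
  have h : A.restrictTo s = A.hadamard (Matrix.vecMulVec (fun i => if i ∈ s then (1 : ℝ) else 0)
      fun i => if i ∈ s then (1 : ℝ) else 0) := by
    ext i j
    by_cases hi : i ∈ s <;> by_cases hj : j ∈ s <;>
        simp [Matrix.restrictTo, Matrix.vecMulVec_apply, hi, hj]
  rw [h]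
  exact hA.hadamard (posSemidef_vecMulVec_self _)

lemma Matrix.PosSemidef.row_eq_zero {A : Matrix V V ℝ} (hA : A.PosSemidef) {v : V}
    (hv : A v v = 0) (j : V) : A v j = 0 := by
  classical
  have h := (hA.dotProduct_mulVec_zero_iff (Pi.single v 1)).1 (by simp [hv])
  rw [hA.apply_comm]
  simpa using congrFun h j

/-- One step of symmetric Gaussian elimination: subtracting the rank-one matrix that agrees with `A`
on row and column `v` leaves a positive semidefinite matrix. If `A v v = 0`, then
nothing is subtracted. -/
lemma Matrix.PosSemidef.sub_smul_vecMulVec {A : Matrix V V ℝ} (hA : A.PosSemidef) (v : V) :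
    (A - (A v v)⁻¹ • Matrix.vecMulVec (A v) (A v)).PosSemidef := by
  classical
  by_cases hv : A v v = 0
  · simpa [hv] using hA
  rw [Matrix.posSemidef_iff_dotProduct_mulVec]
  refine ⟨hA.isHermitian.sub ((posSemidef_vecMulVec_self (A v)).isHermitian.smul (.all _)),
    fun x => ?_⟩
  have h := hA.dotProduct_mulVec_nonneg (x - ((A v v)⁻¹ * (A v ⬝ᵥ x)) • Pi.single v 1)
  have h1 : x ⬝ᵥ A.col v = A v ⬝ᵥ x := by
    rw [dotProduct_comm]
    congr 1
    funext j
    exact hA.apply_comm j v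
  simp only [star_trivial, Matrix.mulVec_sub, Matrix.mulVec_smul, sub_dotProduct, dotProduct_sub,
    smul_dotProduct, dotProduct_smul, single_one_dotProduct, Matrix.mulVec_single_one,
    smul_eq_mul, h1, Matrix.sub_mulVec, Matrix.smul_mulVec, Matrix.vecMulVec_mulVec] at h ⊢
  have h2 : A.mulVec x v = A v ⬝ᵥ x := rfl
  have h3 : A.col v v = A v v := rfl
  rw [h2, h3] at h
  simp only [dotProduct_comm x (A v), MulOpposite.smul_eq_mul_unop, MulOpposite.unop_op]
  refine h.trans_eq ?_
  field_simp
  ring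

lemma Matrix.sub_smul_vecMulVec_apply_self {A : Matrix V V ℝ} (hA : A.PosSemidef) (v j : V) :
    (A - (A v v)⁻¹ • Matrix.vecMulVec (A v) (A v)) v j = 0 := by
  by_cases hv : A v v = 0
  · simp [hv, hA.row_eq_zero hv]
  · simp [Matrix.vecMulVec_apply, hv]

open MeasureTheory in
lemma posSemidef_of_integral {A : Matrix V V ℝ} (F : ℝ → Matrix V V ℝ)
    (hF : ∀ t ∈ Set.Icc (0 : ℝ) 1, (F t).PosSemidef)
    (hint : ∀ i j, IntervalIntegrable (fun t => F t i j) volume 0 1)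
    (hA : ∀ i j, ∫ t in (0 : ℝ)..1, F t i j = A i j) : A.PosSemidef := by
  rw [posSemidef_iff_sum_nonneg]
  constructor
  · intro i j
    rw [← hA, ← hA]
    refine intervalIntegral.integral_congr fun t ht => (hF t ?_).apply_comm i j
    rwa [Set.uIcc_of_le zero_le_one] at ht
  · intro x
    have h : ∑ i, ∑ j, x i * A i j * x j =
        ∫ t in (0 : ℝ)..1, ∑ i, ∑ j, x i * F t i j * x j := by
      have hi : ∀ i j, IntervalIntegrable (fun t => x i * F t i j * x j) volume 0 1 :=
        fun i j => ((hint i j).const_mul _).mul_const _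
      rw [intervalIntegral.integral_finsetSum fun i _ => by
        simpa only [Finset.sum_fn] using IntervalIntegrable.sum Finset.univ fun j _ => hi i j]
      refine Finset.sum_congr rfl fun i _ => ?_
      rw [intervalIntegral.integral_finsetSum fun j _ => hi i j]
      refine Finset.sum_congr rfl fun j _ => ?_
      rw [intervalIntegral.integral_mul_const, intervalIntegral.integral_const_mul, hA]
    rw [h]
    exact intervalIntegral.integral_nonneg zero_le_one fun t ht =>
      (posSemidef_iff_sum_nonneg.1 (hF t ht)).2 x

/-- A positive semidefinite matrix without entries in `D × F` is a sum of two positive semidefinite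
matrices, one vanishing on the rows in `F` and the other on the rows in `D`: eliminate the indices
in `D` one after the other. -/
lemma Matrix.PosSemidef.exists_split {A : Matrix V V ℝ} (hA : A.PosSemidef) (D F : Finset V)
    (h : ∀ i ∈ D, ∀ j ∈ F, A i j = 0) :
    ∃ A₁ A₂ : Matrix V V ℝ, A₁.PosSemidef ∧ A₂.PosSemidef ∧ A = A₁ + A₂ ∧
      (∀ i ∈ F, ∀ j, A₁ i j = 0) ∧ (∀ i ∈ D, ∀ j, A₂ i j = 0) := by
  classical
  induction D using Finset.induction_on generalizing A with
  | empty => exact ⟨0, A, .zero, hA, by simp, by simp, by simp⟩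
  | insert v D hv ih =>
    set R : Matrix V V ℝ := (A v v)⁻¹ • Matrix.vecMulVec (A v) (A v) with hR
    have hRpos : R.PosSemidef := (posSemidef_vecMulVec_self _).smul (inv_nonneg.2 hA.diag_nonneg)
    have hRF : ∀ i j, j ∈ F → R i j = 0 := fun i j hj => by
      simp [hR, Matrix.vecMulVec_apply, h v (by simp) j hj]
    obtain ⟨A₁, A₂, h1, h2, h3, h4, h5⟩ := ih (hA.sub_smul_vecMulVec v) fun i hi j hj => by
      simp [h i (Finset.mem_insert_of_mem hi) j hj, Matrix.vecMulVec_apply, h v (by simp) j hj]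
    -- Row `v` of `A₁ + A₂ = A - R` vanishes, so both diagonal entries at `v` are `0`.
    have hrow : A₁ v v + A₂ v v = 0 := by
      rw [← Matrix.add_apply, ← h3, Matrix.sub_smul_vecMulVec_apply_self hA]
    have hz : A₂ v v = 0 := by
      linarith [h1.diag_nonneg (i := v), h2.diag_nonneg (i := v)]
    refine ⟨R + A₁, A₂, hRpos.add h1, h2, ?_, ?_, ?_⟩
    · rw [add_assoc, ← h3, hR]
      abel
    · intro i hi j
      rw [Matrix.add_apply, h4 i hi, hRpos.apply_comm, hRF j i hi, add_zero]
    · intro i hi j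
      rcases Finset.mem_insert.1 hi with rfl | hi
      · exact h2.row_eq_zero hz j
      · exact h5 i hi j
end

/-! ### Entrywise powers on complete graphs -/

section
variable {V : Type*} [Fintype V]

/-- If `signedPower (!odd) (β - 1)` preserves positivity on the support of `B`, then the entrywise
power `β` is monotone in the direction `B`. -/
lemma posSemidef_signedPower_add_sub_of_deriv (odd : Bool) {β : ℝ} (hβ : 1 ≤ β) {s : Finset V}
    (hP : ∀ A : Matrix V V ℝ, A.PosSemidef → (∀ i ∉ s, ∀ j, A i j = 0) →
      (A.map (signedPower (!odd) (β - 1))).PosSemidef)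
    {A B : Matrix V V ℝ} (hA : A.PosSemidef) (hB : B.PosSemidef) (hBs : ∀ i ∉ s, ∀ j, B i j = 0) :
    ((A + B).map (signedPower odd β) - A.map (signedPower odd β)).PosSemidef := by
  refine posSemidef_of_integral
    (fun t => B.hadamard (β • ((A + t • B).restrictTo s).map (signedPower (!odd) (β - 1)))) ?_ ?_ ?_
  · intro t ht
    refine hB.hadamard (Matrix.PosSemidef.smul (hP _ ?_ ?_) (by linarith))
    · exact (hA.add (hB.smul ht.1)).restrictTo s
    · exact fun i hi j => Matrix.restrictTo_apply_of_notMem_left _ hi j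
  all_goals
    intro i j
    have key : ∀ t : ℝ,
        B.hadamard (β • ((A + t • B).restrictTo s).map (signedPower (!odd) (β - 1))) i j =
          B i j * (β * signedPower (!odd) (β - 1) (A i j + t * B i j)) := by
      intro t
      by_cases hi : i ∈ s
      · by_cases hj : j ∈ s
        · simp [Matrix.restrictTo_apply_of_mem _ hi hj]
        · simp [hB.apply_comm i j, hBs j hj]
      · simp [hBs i hi]
    simp only [key]
  · exact ((intervalIntegrable_signedPower_segment (!odd) (by linarith) _ _).const_mul
      β).const_mul _
  · rw [integral_signedPower_segment odd hβ]
    simp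

/-- Entrywise powers `β ≥ |s| - 1` are monotone in directions supported on `s`, provided
that powers at least `|s| - 2` preserve positivity on `s`. -/
lemma posSemidef_signedPower_add_sub_of_preserves (odd : Bool) {β : ℝ} (hβ0 : 0 ≤ β)
    {s : Finset V} (hβ : (s.card : ℝ) - 1 ≤ β)
    (hP : ∀ (odd : Bool) (α : ℝ), 0 ≤ α → (s.card : ℝ) - 2 ≤ α → ∀ A : Matrix V V ℝ,
      A.PosSemidef → (∀ i ∉ s, ∀ j, A i j = 0) → (A.map (signedPower odd α)).PosSemidef)
    {A B : Matrix V V ℝ} (hA : A.PosSemidef) (hB : B.PosSemidef) (hBs : ∀ i ∉ s, ∀ j, B i j = 0) :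
    ((A + B).map (signedPower odd β) - A.map (signedPower odd β)).PosSemidef := by
  classical
  rcases le_or_gt s.card 1 with hs | hs
  · -- The difference has at most one nonzero entry, which lies on the diagonal.
    have h : (A + B).map (signedPower odd β) - A.map (signedPower odd β) =
        Matrix.diagonal fun i => signedPower odd β (A i i + B i i) - signedPower odd β (A i i) := by
      ext i j
      by_cases hij : i = j
      · subst hij
        simp
      · have hBij : B i j = 0 := by
          by_cases hi : i ∈ s
          · have hj : j ∉ s := fun hj => hij (Finset.card_le_one.1 hs i hi j hj)
            rw [hB.apply_comm, hBs j hj]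
          · exact hBs i hi j
        simp [hij, hBij]
    rw [h, Matrix.posSemidef_diagonal_iff]
    intro i
    have ha := hA.diag_nonneg (i := i)
    have hb := hB.diag_nonneg (i := i)
    rcases ha.eq_or_lt with h0 | h0
    · rw [← h0, zero_add, signedPower_zero, sub_zero, signedPower_of_nonneg _ _ hb, posPower]
      split_ifs
      exacts [le_rfl, Real.rpow_nonneg hb β]
    · rw [signedPower_of_pos _ _ h0, signedPower_of_pos _ _ (by linarith), sub_nonneg]
      exact Real.rpow_le_rpow h0.le (by linarith) hβ0
  · have h2 : (2 : ℝ) ≤ s.card := by exact_mod_cast hs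
    exact posSemidef_signedPower_add_sub_of_deriv odd (by linarith)
      (hP (!odd) (β - 1) (by linarith) (by linarith)) hA hB hBs

/-- Entrywise powers `α ≥ |s| - 2` preserve positivity of matrices supported on `s` (the theorem of
FitzGerald and Horn, in its odd and even versions). -/
theorem posSemidef_map_signedPower (s : Finset V) :
    ∀ (odd : Bool) (α : ℝ), 0 ≤ α → (s.card : ℝ) - 2 ≤ α → ∀ A : Matrix V V ℝ,
      A.PosSemidef → (∀ i ∉ s, ∀ j, A i j = 0) → (A.map (signedPower odd α)).PosSemidef := by
  classical
  induction s using Finset.induction_on with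
  | empty =>
    intro odd α _ _ A _ h
    have : A.map (signedPower odd α) = 0 := by
      ext i j
      simp [h i (by simp) j]
    rw [this]
    exact .zero
  | insert v s hv ih =>
    intro odd α hα0 hα A hA hAs
    rw [Finset.card_insert_of_notMem hv] at hα
    push_cast at hα
    set R : Matrix V V ℝ := (A v v)⁻¹ • Matrix.vecMulVec (A v) (A v) with hR
    have hRpos : R.PosSemidef := (posSemidef_vecMulVec_self _).smul (inv_nonneg.2 hA.diag_nonneg)
    have hfR : (R.map (signedPower odd α)).PosSemidef := by
      have : R.map (signedPower odd α) = signedPower odd α (A v v)⁻¹ •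
          Matrix.vecMulVec (fun i => signedPower odd α (A v i))
            (fun i => signedPower odd α (A v i)) := by
        ext i j
        simp [hR, Matrix.vecMulVec_apply, signedPower_mul]
      rw [this]
      refine (posSemidef_vecMulVec_self _).smul ?_
      have h0 : 0 ≤ (A v v)⁻¹ := inv_nonneg.2 hA.diag_nonneg
      rw [signedPower_of_nonneg _ _ h0, posPower]
      split_ifs
      exacts [le_rfl, Real.rpow_nonneg h0 α]
    have hsub : ∀ i ∉ s, ∀ j, (A - R) i j = 0 := by
      intro i hi j
      by_cases hiv : i = v
      · rw [hiv]
        exact Matrix.sub_smul_vecMulVec_apply_self hA v j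
      · have hi' : i ∉ insert v s := by simp [hi, hiv]
        simp [hR, Matrix.vecMulVec_apply, hA.apply_comm v i, hAs i hi']
    have hM := posSemidef_signedPower_add_sub_of_preserves odd hα0 (by linarith) ih hRpos
      (hA.sub_smul_vecMulVec v) hsub
    rw [add_sub_cancel] at hM
    simpa using hfR.add hM

/-- Entrywise powers `α ≥ |s|` are superadditive on pairs of positive semidefinite matrices whose
supports overlap in `s` only. -/
theorem posSemidef_signedPower_superadditive (odd : Bool) {α : ℝ} (hα0 : 0 ≤ α) {s : Finset V}
    (hα : (s.card : ℝ) ≤ α) {A B : Matrix V V ℝ} (hA : A.PosSemidef) (hB : B.PosSemidef)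
    (h : ∀ i j, i ∉ s → A i j = 0 ∨ B i j = 0) :
    ((A + B).map (signedPower odd α) - A.map (signedPower odd α) -
      B.map (signedPower odd α)).PosSemidef := by
  rcases s.eq_empty_or_nonempty with rfl | hs
  · have : (A + B).map (signedPower odd α) - A.map (signedPower odd α) -
        B.map (signedPower odd α) = 0 := by
      ext i j
      rcases h i j (by simp) with h | h <;> simp [h]
    rw [this]
    exact .zero
  have h1 : (1 : ℝ) ≤ s.card := by exact_mod_cast hs.card_pos
  have hA' := hA.restrictTo s
  have hB' := hB.restrictTo s
  refine posSemidef_of_integral (fun t => (B.restrictTo s).hadamard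
    (α • (((t • B.restrictTo s + A.restrictTo s).map (signedPower (!odd) (α - 1)) -
      (t • B.restrictTo s).map (signedPower (!odd) (α - 1)))))) ?_ ?_ ?_
  · intro t ht
    refine hB'.hadamard (Matrix.PosSemidef.smul ?_ hα0)
    exact posSemidef_signedPower_add_sub_of_preserves (!odd) (by linarith) (by linarith)
      (posSemidef_map_signedPower s) (hB'.smul ht.1) hA'
      fun i hi j => Matrix.restrictTo_apply_of_notMem_left _ hi j
  all_goals
    intro i j
    by_cases hij : i ∈ s ∧ j ∈ s
    swap
    · have h0 : A i j = 0 ∨ B i j = 0 := by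
        by_cases hi : i ∈ s
        · rw [hA.apply_comm, hB.apply_comm]
          exact h j i fun hj => hij ⟨hi, hj⟩
        · exact h i j hi
      have hBij : B.restrictTo s i j = 0 := by simp [Matrix.restrictTo, hij]
      rcases h0 with h0 | h0 <;> simp [hBij, h0]
    have key : ∀ t : ℝ, (B.restrictTo s).hadamard
        (α • (((t • B.restrictTo s + A.restrictTo s).map (signedPower (!odd) (α - 1)) -
          (t • B.restrictTo s).map (signedPower (!odd) (α - 1))))) i j =
        B i j * (α * signedPower (!odd) (α - 1) (A i j + t * B i j)) -
          B i j * (α * signedPower (!odd) (α - 1) (0 + t * B i j)) := by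
      intro t
      simp [Matrix.restrictTo_apply_of_mem _ hij.1 hij.2, add_comm]
      ring
    simp only [key]
    have hi1 := fun a : ℝ => ((intervalIntegrable_signedPower_segment (!odd) (γ := α - 1)
      (by linarith) a (B i j)).const_mul α).const_mul (B i j)
  · exact (hi1 _).sub (hi1 _)
  · rw [intervalIntegral.integral_sub (hi1 _) (hi1 _),
      integral_signedPower_segment odd (by linarith),
      integral_signedPower_segment odd (by linarith)]
    simp
end

/-! ### Clique separations of chordal graphs -/

section
variable {V : Type*}

/-- In a chordal graph, two neighbours `x`, `y` of `b` that are joined by a walk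
with all inner vertices outside the closed neighbourhood of `b` are equal or adjacent: a shortest
such walk, closed up through `b`, has no chord. -/
lemma SimpleGraph.IsChordal.adj_of_walk {G : SimpleGraph V} (hG : G.IsChordal) {b x y : V}
    (hbx : G.Adj b x) (hby : G.Adj b y) (hxy : x ≠ y) (p : G.Walk x y)
    (hp : ∀ z ∈ p.support, z = x ∨ z = y ∨ (z ≠ b ∧ ¬ G.Adj b z)) : G.Adj x y := by
  classical
  by_contra hadj
  let P : ℕ → Prop := fun n => ∃ q : G.Walk x y, q.length = n ∧
    ∀ z ∈ q.support, z = x ∨ z = y ∨ (z ≠ b ∧ ¬ G.Adj b z)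
  have hex : ∃ n, P n := ⟨_, p, rfl, hp⟩
  obtain ⟨q₀, hq₀, hq₀s⟩ := Nat.find_spec hex
  have hmin : ∀ q : G.Walk x y, (∀ z ∈ q.support, z = x ∨ z = y ∨ (z ≠ b ∧ ¬ G.Adj b z)) →
      q₀.bypass.length ≤ q.length := fun q hq =>
    (q₀.length_bypass_le_length).trans (hq₀ ▸ Nat.find_min' hex ⟨q, rfl, hq⟩)
  have hqs : ∀ z ∈ q₀.bypass.support, z = x ∨ z = y ∨ (z ≠ b ∧ ¬ G.Adj b z) :=
    fun z hz => hq₀s z (q₀.support_bypass_subset_support hz)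
  have hpath : q₀.bypass.IsPath := q₀.bypass_isPath
  generalize q₀.bypass = q at hmin hqs hpath
  have hbq : b ∉ q.support := by
    intro hb
    rcases hqs b hb with h | h | h
    · exact hbx.ne h
    · exact hby.ne h
    · exact h.1 rfl
  have hlen : 2 ≤ q.length := by
    by_contra hlt
    have h01 : q.length = 0 ∨ q.length = 1 := by omega
    rcases h01 with h | h
    · exact hxy (SimpleGraph.Walk.eq_of_length_eq_zero h)
    · exact hadj (SimpleGraph.Walk.adj_of_length_eq_one h)
  have hcyc : (SimpleGraph.Walk.cons hbx (q.concat hby.symm)).IsCycle := by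
    rw [SimpleGraph.Walk.cons_isCycle_iff]
    refine ⟨hpath.concat hbq hby.symm, ?_⟩
    rw [SimpleGraph.Walk.edges_concat]
    simp only [List.concat_eq_append, List.mem_append, List.mem_singleton, not_or]
    refine ⟨fun h => hbq (q.fst_mem_support_of_mem_edges h), ?_⟩
    simp [hby.ne, hxy]
  obtain ⟨u, hu, v, hv, huv, hnot⟩ := hG b _ hcyc (by
    rw [SimpleGraph.Walk.length_cons, SimpleGraph.Walk.length_concat]
    omega)
  simp only [SimpleGraph.Walk.support_cons, SimpleGraph.Walk.support_concat,
    SimpleGraph.Walk.edges_cons, SimpleGraph.Walk.edges_concat, List.concat_eq_append,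
    List.mem_cons, List.mem_append, List.not_mem_nil, or_false, not_or] at hu hv hnot
  have hspoke : ∀ w ∈ q.support, G.Adj b w → w = x ∨ w = y := fun w hw hbw => by
    rcases hqs w hw with h | h | h
    exacts [Or.inl h, Or.inr h, absurd hbw h.2]
  have hbend : ∀ w, w = b ∨ w ∈ q.support ∨ w = b → w = b ∨ w ∈ q.support := by tauto
  rcases hbend u hu with rfl | hu'
  · rcases hbend v hv with rfl | hv'
    · exact huv.ne rfl
    · rcases hspoke v hv' huv with rfl | rfl
      · exact hnot.1 rfl
      · exact hnot.2.2 Sym2.eq_swap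
  rcases hbend v hv with rfl | hv'
  · rcases hspoke u hu' huv.symm with rfl | rfl
    · exact hnot.1 Sym2.eq_swap
    · exact hnot.2.2 rfl
  -- A chord of the path `q` would give a shorter walk.
  have hshort : ∀ i j, i < j → j ≤ q.length → G.Adj (q.getVert i) (q.getVert j) →
      s(q.getVert i, q.getVert j) ∉ q.edges → False := by
    intro i j hij hj hadj' hne
    have hij' : i + 1 ≠ j := by
      rintro rfl
      exact hne (q.adj_toSubgraph_iff_mem_edges.1 (q.toSubgraph_adj_getVert (by omega)))
    have := hmin ((q.take i).append (SimpleGraph.Walk.cons hadj' (q.drop j))) (by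
      intro z hz
      refine hqs z ?_
      rw [SimpleGraph.Walk.mem_support_append_iff, SimpleGraph.Walk.support_cons,
        List.mem_cons] at hz
      rcases hz with hz | rfl | hz
      · exact (q.isSubwalk_take i).support_subset hz
      · exact q.getVert_mem_support i
      · exact (q.isSubwalk_drop j).support_subset hz)
    rw [SimpleGraph.Walk.length_append, SimpleGraph.Walk.length_cons,
      SimpleGraph.Walk.take_length, SimpleGraph.Walk.drop_length] at this
    omega
  obtain ⟨i, rfl, hi⟩ := SimpleGraph.Walk.mem_support_iff_exists_getVert.1 hu'
  obtain ⟨j, rfl, hj⟩ := SimpleGraph.Walk.mem_support_iff_exists_getVert.1 hv'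
  rcases lt_trichotomy i j with h | h | h
  · exact hshort i j h hj huv hnot.2.1
  · exact huv.ne (by rw [h])
  · exact hshort j i h hi huv.symm (by rw [Sym2.eq_swap]; exact hnot.2.1)

/-- The clique `C` separates the vertex sets `D` and `F` from each other. -/
structure SimpleGraph.IsCliqueSeparation (G : SimpleGraph V) (D C F : Finset V) : Prop where
  isClique : G.IsClique (C : Set V)
  disjoint_left : Disjoint D C
  disjoint_right : Disjoint F C
  disjoint_sides : Disjoint D F
  not_adj : ∀ d ∈ D, ∀ f ∈ F, ¬ G.Adj d f

lemma SimpleGraph.IsCliqueSeparation.symm {G : SimpleGraph V} {D C F : Finset V}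
    (h : G.IsCliqueSeparation D C F) : G.IsCliqueSeparation F C D :=
  ⟨h.isClique, h.disjoint_right, h.disjoint_left, h.disjoint_sides.symm,
    fun f hf d hd hadj => h.not_adj d hd f hf hadj.symm⟩

/-- Nonadjacent vertices `a`, `b` of a chordal graph are separated by a clique: the
neighbours of `b` next to the component of `a` outside the closed neighbourhood of `b`. -/
lemma SimpleGraph.IsChordal.exists_isCliqueSeparation [DecidableEq V] {G : SimpleGraph V}
    (hG : G.IsChordal) {s : Finset V} {a b : V} (ha : a ∈ s) (hb : b ∈ s) (hab : a ≠ b)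
    (hadj : ¬ G.Adj a b) :
    ∃ D C F : Finset V, G.IsCliqueSeparation D C F ∧ D ∪ C ∪ F = s ∧ a ∈ D ∧ b ∈ F := by
  classical
  let R : V → Prop := fun d =>
    ∃ p : G.Walk a d, ∀ z ∈ p.support, z ∈ s ∧ z ≠ b ∧ ¬ G.Adj b z
  have hRb : ∀ d, R d → d ≠ b ∧ ¬ G.Adj b d := fun d ⟨p, hp⟩ => (hp d p.end_mem_support).2
  have hRstep : ∀ d c, R d → G.Adj d c → c ∈ s → c ≠ b → ¬ G.Adj b c → R c := by
    rintro d c ⟨p, hp⟩ hdc hcs hcb hbc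
    refine ⟨p.concat hdc, fun z hz => ?_⟩
    rw [SimpleGraph.Walk.support_concat] at hz
    simp only [List.mem_append, List.mem_singleton] at hz
    rcases hz with hz | rfl
    exacts [hp z hz, ⟨hcs, hcb, hbc⟩]
  let N : V → Prop := fun c => ∃ d, R d ∧ G.Adj d c
  have hNb : ∀ c ∈ s, ¬ R c → N c → G.Adj b c := by
    rintro c hcs hRc ⟨d, hd, hdc⟩
    by_contra hbc
    refine hRc (hRstep d c hd hdc hcs ?_ hbc)
    rintro rfl
    exact (hRb d hd).2 hdc.symm
  have hRa : R a := ⟨.nil, fun z hz => by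
    rw [SimpleGraph.Walk.support_nil, List.mem_singleton] at hz
    subst hz
    exact ⟨ha, hab, fun h => hadj h.symm⟩⟩
  refine ⟨s.filter R, s.filter fun c => ¬ R c ∧ N c, s.filter fun f => ¬ R f ∧ ¬ N f,
    ⟨?_, ?_, ?_, ?_, ?_⟩, ?_, ?_, ?_⟩
  · intro x hx y hy hxy
    simp only [Finset.coe_filter, Set.mem_ofPred_eq] at hx hy
    obtain ⟨hxs, hRx, d, ⟨p, hp⟩, hdx⟩ := hx
    obtain ⟨hys, hRy, e, ⟨q, hq⟩, hey⟩ := hy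
    refine hG.adj_of_walk (hNb x hxs hRx ⟨d, ⟨p, hp⟩, hdx⟩) (hNb y hys hRy ⟨e, ⟨q, hq⟩, hey⟩) hxy
      (SimpleGraph.Walk.cons hdx.symm ((p.reverse.append q).concat hey)) fun z hz => ?_
    simp only [SimpleGraph.Walk.support_cons, SimpleGraph.Walk.support_concat,
      List.mem_cons, List.mem_append, SimpleGraph.Walk.support_reverse,
      SimpleGraph.Walk.mem_support_append_iff, List.mem_reverse, List.not_mem_nil,
      or_false] at hz
    rcases hz with rfl | (hz | hz) | rfl
    exacts [Or.inl rfl, Or.inr (Or.inr (hp z hz).2), Or.inr (Or.inr (hq z hz).2),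
      Or.inr (Or.inl rfl)]
  · exact Finset.disjoint_filter.2 fun x _ h1 h2 => h2.1 h1
  · exact Finset.disjoint_filter.2 fun x _ h1 h2 => h1.2 h2.2
  · exact Finset.disjoint_filter.2 fun x _ h1 h2 => h2.1 h1
  · intro d hd f hf h
    exact (Finset.mem_filter.1 hf).2.2 ⟨d, (Finset.mem_filter.1 hd).2, h⟩
  · ext x
    simp only [Finset.mem_union, Finset.mem_filter]
    by_cases R x <;> by_cases N x <;> simp [*]
  · exact Finset.mem_filter.2 ⟨ha, hRa⟩
  · refine Finset.mem_filter.2 ⟨hb, fun h => (hRb b h).1 rfl, ?_⟩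
    rintro ⟨d, hd, hdb⟩
    exact (hRb d hd).2 hdb.symm

/-- A vertex set of a chordal graph is a clique, or it is separated by a clique `C`
such that both sides contain a vertex adjacent to all of `C`. If one of the sides together with `C`
is not a clique, then it is itself separated in this way, and the other side can
be added to one of the parts. -/
theorem SimpleGraph.IsChordal.exists_full_isCliqueSeparation [DecidableEq V] {G : SimpleGraph V}
    (hG : G.IsChordal) (s : Finset V) (hs : ¬ G.IsClique (s : Set V)) :
    ∃ D C F : Finset V, G.IsCliqueSeparation D C F ∧ D ∪ C ∪ F = s ∧
      ∃ a ∈ D, ∃ b ∈ F, ∀ c ∈ C, G.Adj a c ∧ G.Adj b c := by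
  induction s using Finset.strongInduction with
  | H s ih =>
    obtain ⟨a, ha, b, hb, hab, hadj⟩ : ∃ a ∈ s, ∃ b ∈ s, a ≠ b ∧ ¬ G.Adj a b := by
      simpa [SimpleGraph.IsClique, Set.Pairwise] using hs
    obtain ⟨D, C, F, hsep, hunion, haD, hbF⟩ := hG.exists_isCliqueSeparation ha hb hab hadj
    have extend : ∀ D C F : Finset V, G.IsCliqueSeparation D C F → D ∪ C ∪ F = s → F.Nonempty →
        ¬ G.IsClique ((D ∪ C : Finset V) : Set V) →
        ∃ D C F : Finset V, G.IsCliqueSeparation D C F ∧ D ∪ C ∪ F = s ∧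
          ∃ a ∈ D, ∃ b ∈ F, ∀ c ∈ C, G.Adj a c ∧ G.Adj b c := by
      intro D C F hsep hunion hF hnot
      have hdisj : Disjoint (D ∪ C) F :=
        Finset.disjoint_union_left.2 ⟨hsep.disjoint_sides, hsep.disjoint_right.symm⟩
      have hlt : D ∪ C ⊂ s := by
        obtain ⟨f, hf⟩ := hF
        refine Finset.ssubset_iff_of_subset (hunion ▸ Finset.subset_union_left) |>.2
          ⟨f, hunion ▸ Finset.mem_union_right _ hf, fun h => Finset.disjoint_left.1 hdisj h hf⟩
      obtain ⟨D₁, C₁, F₁, hsep₁, hunion₁, a, ha, b, hb, hfull⟩ := ih _ hlt hnot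
      -- The side that `C` does not meet lies in `D`, hence has no edge to `F`.
      have attach : ∀ D₁ F₁ : Finset V, G.IsCliqueSeparation D₁ C₁ F₁ → D₁ ∪ C₁ ∪ F₁ = D ∪ C →
          Disjoint C F₁ → G.IsCliqueSeparation (D₁ ∪ F) C₁ F₁ := by
        intro D₁ F₁ hsep₁ hunion₁ hCF
        have hF₁ : ∀ x ∈ F₁, x ∈ D := fun x hx => by
          have : x ∈ D ∪ C := hunion₁ ▸ Finset.mem_union_right _ hx
          rcases Finset.mem_union.1 this with h | h
          exacts [h, absurd hx (Finset.disjoint_left.1 hCF h)]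
        refine ⟨hsep₁.isClique, ?_, hsep₁.disjoint_right, ?_, ?_⟩
        · refine Finset.disjoint_union_left.2 ⟨hsep₁.disjoint_left, ?_⟩
          refine (Finset.disjoint_of_subset_left ?_ hdisj).symm
          rw [← hunion₁]
          exact Finset.subset_union_right.trans Finset.subset_union_left
        · refine Finset.disjoint_union_left.2 ⟨hsep₁.disjoint_sides, ?_⟩
          exact (Finset.disjoint_of_subset_left hF₁ hsep.disjoint_sides).symm
        · intro d hd f hf h
          rcases Finset.mem_union.1 hd with hd | hd
          · exact hsep₁.not_adj d hd f hf h
          · exact hsep.not_adj f (hF₁ f hf) d hd h.symm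
      by_cases hCF : Disjoint C F₁
      · refine ⟨D₁ ∪ F, C₁, F₁, attach D₁ F₁ hsep₁ hunion₁ hCF, ?_, a,
          Finset.mem_union_left _ ha, b, hb, hfull⟩
        rw [← hunion, ← hunion₁]
        ac_rfl
      · have hCD : Disjoint C D₁ := by
          obtain ⟨y, hyC, hyF⟩ := Finset.not_disjoint_iff.1 hCF
          refine Finset.disjoint_left.2 fun x hxC hxD => ?_
          have hxy : x ≠ y := by
            rintro rfl
            exact Finset.disjoint_left.1 hsep₁.disjoint_sides hxD hyF
          exact hsep₁.not_adj x hxD y hyF (hsep.isClique hxC hyC hxy)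
        have hunion₁' : F₁ ∪ C₁ ∪ D₁ = D ∪ C := by
          rw [← hunion₁]
          ac_rfl
        refine ⟨D₁, C₁, F₁ ∪ F, (attach F₁ D₁ hsep₁.symm hunion₁' hCD).symm, ?_, a, ha, b,
          Finset.mem_union_left _ hb, hfull⟩
        rw [← hunion, ← hunion₁]
        ac_rfl
    by_cases hD : G.IsClique ((D ∪ C : Finset V) : Set V)
    · by_cases hF : G.IsClique ((F ∪ C : Finset V) : Set V)
      · refine ⟨D, C, F, hsep, hunion, a, haD, b, hbF, fun c hc => ⟨?_, ?_⟩⟩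
        · refine hD (by simp [haD]) (by simp [hc]) ?_
          rintro rfl
          exact Finset.disjoint_left.1 hsep.disjoint_left haD hc
        · refine hF (by simp [hbF]) (by simp [hc]) ?_
          rintro rfl
          exact Finset.disjoint_left.1 hsep.disjoint_right hbF hc
      · refine extend F C D hsep.symm ?_ ⟨a, haD⟩ hF
        rw [← hunion]
        ac_rfl
    · exact extend D C F hsep hunion ⟨b, hbF⟩ hD
end

/-! ### Entrywise powers on chordal graphs -/

section
variable {V : Type*}

lemma SimpleGraph.IsClique.completeMinusEdge_isContained {G : SimpleGraph V} {s : Finset V}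
    (hs : G.IsClique (s : Set V)) : (completeMinusEdge s.card).IsContained G := by
  refine ⟨⟨⟨fun i => (s.equivFin.symm i : V), fun {i j} h => ?_⟩, ?_⟩⟩
  · refine hs (s.equivFin.symm i).2 (s.equivFin.symm j).2 fun h' => h.1 ?_
    exact s.equivFin.symm.injective (Subtype.ext h')
  · exact fun i j h => s.equivFin.symm.injective (Subtype.ext h)

/-- Two vertices joined to all vertices of a clique `C` span a copy of `K_{|C| + 2}^{(1)}`. -/
lemma SimpleGraph.IsClique.completeMinusEdge_add_two_isContained {G : SimpleGraph V}
    {C : Finset V} (hC : G.IsClique (C : Set V)) {a b : V} (hab : a ≠ b)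
    (hfull : ∀ c ∈ C, G.Adj a c ∧ G.Adj b c) :
    (completeMinusEdge (C.card + 2)).IsContained G := by
  let e : Fin C.card → V := fun i => (C.equivFin.symm i : V)
  have he : ∀ i, e i ∈ C := fun i => (C.equivFin.symm i).2
  have hinj : Function.Injective e := fun i j h => C.equivFin.symm.injective (Subtype.ext h)
  have ha : ∀ i, G.Adj a (e i) := fun i => (hfull _ (he i)).1
  have hb : ∀ i, G.Adj b (e i) := fun i => (hfull _ (he i)).2
  let g : Fin (C.card + 2) → V := Fin.cons a (Fin.cons b e : Fin (C.card + 1) → V)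
  refine ⟨⟨⟨g, fun {i j} h => ?_⟩, ?_⟩⟩
  · obtain ⟨hij, hsum⟩ := h
    induction i using Fin.cases with
    | zero =>
      induction j using Fin.cases with
      | zero => exact absurd rfl hij
      | succ j =>
        induction j using Fin.cases with
        | zero => simp at hsum
        | succ j => exact ha j
    | succ i =>
      induction i using Fin.cases with
      | zero =>
        induction j using Fin.cases with
        | zero => simp at hsum
        | succ j =>
          induction j using Fin.cases with
          | zero => exact absurd rfl hij
          | succ j => exact hb j
      | succ i =>
        induction j using Fin.cases with
        | zero => exact (ha i).symm
        | succ j =>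
          induction j using Fin.cases with
          | zero => exact (hb i).symm
          | succ j =>
            refine hC (he i) (he j) fun h => hij ?_
            rw [hinj h]
  · change Function.Injective g
    refine Fin.cons_injective_iff.2 ⟨?_, Fin.cons_injective_iff.2 ⟨?_, hinj⟩⟩
    · rintro ⟨i, hi⟩
      induction i using Fin.cases with
      | zero => exact hab hi.symm
      | succ i => exact (ha i).ne hi.symm
    · rintro ⟨i, hi⟩
      exact (hb i).ne hi.symm

/-- On a chordal graph all powers from `r - 2` on preserve positivity: cut along a clique `C` with
`|C| + 2 ≤ r`, where superadditivity controls the overlap, until only cliques remain. -/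
theorem SimpleGraph.IsChordal.posSemidef_map_signedPower [Fintype V] {G : SimpleGraph V}
    (hG : G.IsChordal) {r : ℕ} (hr : ∀ k, (completeMinusEdge k).IsContained G → k ≤ r)
    (odd : Bool) {α : ℝ} (hα0 : 0 ≤ α) (hα : (r : ℝ) - 2 ≤ α) (s : Finset V) :
    ∀ A : Matrix V V ℝ, A.PosSemidef → (∀ i ∉ s, ∀ j, A i j = 0) →
      (∀ i j, i ≠ j → ¬ G.Adj i j → A i j = 0) → (A.map (signedPower odd α)).PosSemidef := by
  classical
  induction s using Finset.strongInduction with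
  | H s ih =>
    intro A hA hAs hAG
    by_cases hs : G.IsClique (s : Set V)
    · have h1 : (s.card : ℝ) ≤ r := by exact_mod_cast hr _ hs.completeMinusEdge_isContained
      exact _root_.posSemidef_map_signedPower s odd α hα0 (by linarith) A hA hAs
    obtain ⟨D, C, F, hsep, hunion, a, ha, b, hb, hfull⟩ := hG.exists_full_isCliqueSeparation s hs
    have hab : a ≠ b := by
      rintro rfl
      exact Finset.disjoint_left.1 hsep.disjoint_sides ha hb
    have hCr : ((C.card + 2 : ℕ) : ℝ) ≤ r := by
      exact_mod_cast hr _ (hsep.isClique.completeMinusEdge_add_two_isContained hab hfull)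
    push_cast at hCr
    have hDF : ∀ i ∈ D, ∀ j ∈ F, A i j = 0 := fun i hi j hj =>
      hAG i j (fun h => Finset.disjoint_left.1 hsep.disjoint_sides hi (h ▸ hj))
        (hsep.not_adj i hi j hj)
    -- The indices outside `s` are eliminated together with `D`, so that `A₂` lives on `C ∪ F`.
    obtain ⟨A₁, A₂, h1, h2, hsum, hF, hD⟩ := hA.exists_split (D ∪ sᶜ) F fun i hi j hj => by
      rcases Finset.mem_union.1 hi with hi | hi
      exacts [hDF i hi j hj, hAs i (Finset.mem_compl.1 hi) j]
    have hval : ∀ i j, A i j = A₁ i j + A₂ i j := fun i j => by rw [hsum, Matrix.add_apply]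
    have hA₁s : ∀ i ∉ s, ∀ j, A₁ i j = 0 := fun i hi j => by
      have h0 := hval i j
      rw [hAs i hi, hD i (by simp [hi]), add_zero] at h0
      exact h0.symm
    have hcases : ∀ i, i ∉ C → (∀ j, A₁ i j = 0) ∨ ∀ j, A₂ i j = 0 := fun i hi => by
      by_cases his : i ∈ s
      · rw [← hunion, Finset.mem_union, Finset.mem_union] at his
        rcases his with (h | h) | h
        exacts [Or.inr (hD i (Finset.mem_union_left _ h)), absurd h hi, Or.inl (hF i h)]
      · exact Or.inl (hA₁s i his)
    have hG' : ∀ i j, i ≠ j → ¬ G.Adj i j → A₁ i j = 0 ∧ A₂ i j = 0 := by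
      intro i j hij hadj
      have h0 := hAG i j hij hadj
      rw [hval] at h0
      have h3 : A₁ i j = 0 ∨ A₂ i j = 0 := by
        by_cases hi : i ∈ C
        · have hj : j ∉ C := fun hj => hadj (hsep.isClique hi hj hij)
          rw [h1.apply_comm, h2.apply_comm]
          exact (hcases j hj).imp (fun h => h i) (fun h => h i)
        · exact (hcases i hi).imp (fun h => h j) (fun h => h j)
      rcases h3 with h3 | h3 <;> rw [h3] at h0 ⊢ <;> simpa using h0
    have hlt₁ : D ∪ C ⊂ s := by
      refine Finset.ssubset_iff_of_subset (hunion ▸ Finset.subset_union_left) |>.2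
        ⟨b, hunion ▸ Finset.mem_union_right _ hb, fun h => ?_⟩
      rcases Finset.mem_union.1 h with h | h
      exacts [Finset.disjoint_left.1 hsep.disjoint_sides h hb,
        Finset.disjoint_left.1 hsep.disjoint_right hb h]
    have hlt₂ : F ∪ C ⊂ s := by
      refine Finset.ssubset_iff_of_subset ?_ |>.2 ⟨a, ?_, fun h => ?_⟩
      · rw [← hunion]
        intro x hx
        simp only [Finset.mem_union] at hx ⊢
        tauto
      · rw [← hunion]
        simp [ha]
      · rcases Finset.mem_union.1 h with h | h
        exacts [Finset.disjoint_left.1 hsep.disjoint_sides ha h,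
          Finset.disjoint_left.1 hsep.disjoint_left ha h]
    have hp₁ := ih _ hlt₁ A₁ h1 (fun i hi j => by
      by_cases his : i ∈ s
      · rw [← hunion, Finset.mem_union] at his
        exact hF i (his.resolve_left hi) j
      · exact hA₁s i his j) fun i j hij hadj => (hG' i j hij hadj).1
    have hp₂ := ih _ hlt₂ A₂ h2 (fun i hi j => by
      refine hD i ?_ j
      by_cases his : i ∈ s
      · rw [← hunion] at his
        simp only [Finset.mem_union] at his hi ⊢
        tauto
      · simp [his]) fun i j hij hadj => (hG' i j hij hadj).2
    have hE := posSemidef_signedPower_superadditive odd hα0 (s := C) (by linarith) h1 h2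
      fun i j hi => (hcases i hi).imp (fun h => h j) (fun h => h j)
    have hfin := (hp₁.add hp₂).add hE
    rw [← hsum] at hfin
    convert hfin using 1
    abel
end

/-! ### Failure of small powers: the analytic part -/

section
open Asymptotics Topology Filter

/-- Weights for a linear functional supported on `m + 1` points, one of which is `s`, that vanishes
on `t, …, t ^ m` but not on `f`: the error at `s` of interpolating at `0, …, m`. The node `0`
does not contribute, since `f 0 = 0`, and its place is taken by `s`. -/
lemma exists_weights {f : ℝ → ℝ} (hf0 : f 0 = 0) (m : ℕ) {s : ℝ}
    (hs : f s ≠ (Lagrange.interpolate Finset.univ (fun i : Fin (m + 1) => (i : ℝ))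
      fun i => f i).eval s) :
    ∃ x y : Fin (m + 1) → ℝ, (∀ i, x i = s ∨ 0 ≤ x i) ∧
      (∀ k, 1 ≤ k → k ≤ m → ∑ i, y i * x i ^ k = 0) ∧ ∑ i, y i * f (x i) ≠ 0 := by
  set v : Fin (m + 1) → ℝ := fun i => (i : ℝ) with hv
  have hinj : Set.InjOn v (Finset.univ : Finset (Fin (m + 1))) := fun i _ j _ h => by
    simpa [hv, Fin.ext_iff] using h
  let x : Fin (m + 1) → ℝ := Fin.cons s fun i => v i.succ
  let y : Fin (m + 1) → ℝ := Fin.cons 1 fun i =>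
    -(Lagrange.basis Finset.univ v i.succ).eval s
  have key : ∀ g : ℝ → ℝ, g 0 = 0 → ∑ i, y i * g (x i) =
      g s - (Lagrange.interpolate Finset.univ v fun i => g (v i)).eval s := by
    intro g hg
    have hv0 : v 0 = 0 := by simp [hv]
    rw [Lagrange.interpolate_apply, Polynomial.eval_finsetSum, Fin.sum_univ_succ,
      Fin.sum_univ_succ (n := m)]
    simp [x, y, hv0, hg, mul_comm, sub_eq_add_neg]
  refine ⟨x, y, fun i => ?_, fun k hk1 hkm => ?_, ?_⟩
  · induction i using Fin.cases with
    | zero => exact Or.inl rfl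
    | succ i => exact Or.inr (by simp only [x, Fin.cons_succ, hv]; positivity)
  · have h1 := key (fun t => t ^ k) (by simp; omega)
    rw [h1]
    have h2 := Lagrange.eq_interpolate (f := (Polynomial.X ^ k : Polynomial ℝ)) hinj (by
      rw [Polynomial.degree_X_pow, Finset.card_univ, Fintype.card_fin]
      exact_mod_cast Nat.lt_succ_of_le hkm)
    simp only [Polynomial.eval_pow, Polynomial.eval_X] at h2
    rw [← h2]
    simp
  · rw [key f hf0, sub_ne_zero]
    exact hs

/-- The sum of the rank-one matrices `(1, u)(1, u)ᵀ` on `{a} ∪ C` and `(1, v)(1, v)ᵀ` on `{b} ∪ C`,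
where `u = (1, …, 1)` and `v = δ x`. The index type is `Fin 2 ⊕ Fin (m + 1)`, with `a`, `b` the
elements of `Fin 2` and `C = Fin (m + 1)`. -/
noncomputable def gluedMatrix {m : ℕ} (δ : ℝ) (x : Fin (m + 1) → ℝ) :
    Matrix (Fin 2 ⊕ Fin (m + 1)) (Fin 2 ⊕ Fin (m + 1)) ℝ :=
  Matrix.vecMulVec (Sum.elim ![1, 0] fun _ => 1) (Sum.elim ![1, 0] fun _ => 1) +
    Matrix.vecMulVec (Sum.elim ![0, 1] fun i => δ * x i) (Sum.elim ![0, 1] fun i => δ * x i)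

/-- Positivity of the glued matrix bounds from below the quadratic form on `C`: this is the
quadratic form of the Schur complement of the block `{a, b}`. -/
lemma sum_sq_le_of_posSemidef_gluedMatrix {f : ℝ → ℝ} (hf0 : f 0 = 0) (hf1 : f 1 = 1)
    (hmul : ∀ x y, f (x * y) = f x * f y) {m : ℕ} {ε : ℝ} (hε : 0 ≤ ε) (x y : Fin (m + 1) → ℝ)
    (h : ((gluedMatrix (√ε) x).map f).PosSemidef) :
    (∑ i, y i) ^ 2 + f ε * (∑ i, y i * f (x i)) ^ 2 ≤
      ∑ i, ∑ j, y i * f (1 + ε * (x i * x j)) * y j := by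
  set S := ∑ i, y i with hS
  set T := ∑ i, y i * f (x i) with hT
  have h1 := (posSemidef_iff_sum_nonneg.1 h).2 (Sum.elim ![-S, -(f √ε * T)] y)
  have h2 : ∀ i j, 1 + √ε * x i * (√ε * x j) = 1 + ε * (x i * x j) := fun i j => by
    linear_combination (x i * x j) * Real.mul_self_sqrt hε
  have h3 : f ε = f √ε * f √ε := by rw [← hmul, Real.mul_self_sqrt hε]
  have h4 : ∑ j, f √ε * f (x j) * y j = f √ε * T := by
    rw [hT, Finset.mul_sum]
    exact Finset.sum_congr rfl fun i _ => by ring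
  have h5 : ∀ c : ℝ, ∑ j, c * (f √ε * f (x j)) * y j = c * (f √ε * T) := fun c => by
    rw [← h4, Finset.mul_sum]
    exact Finset.sum_congr rfl fun i _ => by ring
  have h6 : ∑ j, y j * (f √ε * f (x j)) = f √ε * T := by
    rw [← h4]
    exact Finset.sum_congr rfl fun i _ => by ring
  simp only [gluedMatrix, Fintype.sum_sum_type, Fin.sum_univ_two, Matrix.map_apply,
    Matrix.add_apply, Matrix.vecMulVec_apply, Sum.elim_inl, Sum.elim_inr, Matrix.cons_val_zero,
    Matrix.cons_val_one, mul_one, mul_zero, zero_mul, one_mul, add_zero, zero_add, hf0,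
    hf1, hmul √ε, h2, Finset.sum_add_distrib, h5, ← Finset.mul_sum, ← Finset.sum_mul,
    ← hS] at h1
  rw [h6] at h1
  rw [h3]
  linarith

/-- If `f` is multiplicative with `f ε = ε ^ α` for `ε > 0` and agrees near `1` with a polynomial up
to an error `O(ε ^ (m + 1))`, where `α < m + 1`, then the glued matrices witness that `f` does not
preserve positivity: on the weights of `exists_weights` the polynomial part cancels, and the
remaining term `- ε ^ α` dominates the error. -/
lemma exists_not_posSemidef_gluedMatrix {f : ℝ → ℝ} {α : ℝ} (hf0 : f 0 = 0) (hf1 : f 1 = 1)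
    (hmul : ∀ x y, f (x * y) = f x * f y) (hpos : ∀ t, 0 < t → f t = t ^ α) {m : ℕ}
    (hα : α < m + 1) {c : ℕ → ℝ} (hc0 : c 0 = 1)
    (hexp : (fun t => f (1 + t) - ∑ k ∈ Finset.range (m + 1), c k * t ^ k)
      =O[𝓝 0] fun t => ‖t‖ ^ (m + 1))
    {x y : Fin (m + 1) → ℝ} (hxy : ∀ k, 1 ≤ k → k ≤ m → ∑ i, y i * x i ^ k = 0)
    (hT : ∑ i, y i * f (x i) ≠ 0) :
    ∃ δ, 0 ≤ δ ∧ ¬ ((gluedMatrix δ x).map f).PosSemidef := by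
  by_contra! hall
  set T := ∑ i, y i * f (x i) with hTdef
  -- The polynomial part of the quadratic form reduces to its constant term.
  have hpoly : ∀ ε : ℝ, ∑ i, ∑ j, y i * (∑ k ∈ Finset.range (m + 1),
      c k * (ε * (x i * x j)) ^ k) * y j = (∑ i, y i) ^ 2 := by
    intro ε
    have h1 : ∀ i j, y i * (∑ k ∈ Finset.range (m + 1), c k * (ε * (x i * x j)) ^ k) * y j =
        ∑ k ∈ Finset.range (m + 1), (c k * ε ^ k) * ((y i * x i ^ k) * (y j * x j ^ k)) := by
      intro i j
      rw [Finset.mul_sum, Finset.sum_mul]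
      refine Finset.sum_congr rfl fun k _ => ?_
      rw [mul_pow, mul_pow]
      ring
    simp only [h1]
    have h2 : ∀ i, ∑ j, ∑ k ∈ Finset.range (m + 1),
        (c k * ε ^ k) * ((y i * x i ^ k) * (y j * x j ^ k)) = ∑ k ∈ Finset.range (m + 1),
        (c k * ε ^ k) * ((y i * x i ^ k) * ∑ j, y j * x j ^ k) := by
      intro i
      rw [Finset.sum_comm]
      simp only [Finset.mul_sum]
    simp only [h2]
    rw [Finset.sum_comm, Finset.sum_eq_single_of_mem 0 (by simp)]
    · simp [hc0, ← Finset.sum_mul, sq]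
    · intro k hk hk0
      rw [hxy k (Nat.one_le_iff_ne_zero.2 hk0) (Nat.lt_succ_iff.1 (Finset.mem_range.1 hk))]
      simp
  have hbig : (fun ε : ℝ => ∑ i, ∑ j, y i * f (1 + ε * (x i * x j)) * y j - (∑ i, y i) ^ 2)
      =O[𝓝 0] fun ε => ‖ε‖ ^ (m + 1) := by
    have h1 : (fun ε : ℝ => ∑ i, ∑ j, y i * f (1 + ε * (x i * x j)) * y j - (∑ i, y i) ^ 2) =
        fun ε => ∑ i, ∑ j, y i * (f (1 + ε * (x i * x j)) - ∑ k ∈ Finset.range (m + 1),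
          c k * (ε * (x i * x j)) ^ k) * y j := by
      funext ε
      rw [← hpoly ε]
      simp only [mul_sub, sub_mul, Finset.sum_sub_distrib]
    rw [h1]
    refine IsBigO.fun_sum fun i _ => ?_
    refine IsBigO.fun_sum fun j _ => ?_
    have ht : Tendsto (fun ε : ℝ => ε * (x i * x j)) (𝓝 0) (𝓝 0) := by
      have : Continuous fun ε : ℝ => ε * (x i * x j) := by fun_prop
      simpa using this.tendsto 0
    have h2 := hexp.comp_tendsto ht
    have h3 : (fun ε : ℝ => ‖ε * (x i * x j)‖ ^ (m + 1)) =O[𝓝 0] fun ε : ℝ => ‖ε‖ ^ (m + 1) := by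
      refine (isBigO_const_mul_self (‖x i * x j‖ ^ (m + 1)) (fun ε : ℝ => ‖ε‖ ^ (m + 1))
        (𝓝 0)).congr_left fun ε => ?_
      rw [norm_mul ε, mul_pow, mul_comm]
    have h4 := ((h2.trans h3).const_mul_left (y i)).const_mul_left (y j)
    simpa only [Function.comp_def, mul_comm (y j)] using h4
  obtain ⟨K, hK⟩ := hbig.bound
  have hev : ∀ᶠ ε : ℝ in 𝓝[>] 0, T ^ 2 ≤ K * ε ^ ((m : ℝ) + 1 - α) := by
    filter_upwards [nhdsWithin_le_nhds hK, self_mem_nhdsWithin] with ε hKε hε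
    have hε' : 0 < ε := hε
    have h1 := sum_sq_le_of_posSemidef_gluedMatrix hf0 hf1 hmul hε'.le x y
      (hall _ (Real.sqrt_nonneg ε))
    rw [hpos ε hε', ← hTdef] at h1
    have h2 := (le_abs_self _).trans hKε
    have h3 : ε ^ α * T ^ 2 ≤ K * ε ^ (m + 1) := by
      rw [Real.norm_of_nonneg (by positivity), Real.norm_of_nonneg hε'.le] at h2
      linarith
    have h4 : ε ^ (m + 1) = ε ^ α * ε ^ ((m : ℝ) + 1 - α) := by
      rw [← Real.rpow_add hε', ← Real.rpow_natCast]
      congr 1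
      push_cast
      ring
    rw [h4] at h3
    have h5 : 0 < ε ^ α := Real.rpow_pos_of_pos hε' α
    refine le_of_mul_le_mul_left ?_ h5
    linarith
  have hlim : Tendsto (fun ε : ℝ => K * ε ^ ((m : ℝ) + 1 - α)) (𝓝[>] 0) (𝓝 0) := by
    have h0 : 0 < (m : ℝ) + 1 - α := by linarith
    have : Tendsto (fun ε : ℝ => K * ε ^ ((m : ℝ) + 1 - α)) (𝓝 0) (𝓝 (K * 0 ^ ((m : ℝ) + 1 - α))) :=
      ((Real.continuousAt_rpow_const 0 _ (Or.inr h0.le)).tendsto).const_mul K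
    rw [Real.zero_rpow h0.ne', mul_zero] at this
    exact this.mono_left nhdsWithin_le_nhds
  have hT2 : T ^ 2 ≤ 0 := ge_of_tendsto hlim hev
  exact hT (pow_eq_zero_iff two_ne_zero |>.1 (le_antisymm hT2 (sq_nonneg T)))

lemma exists_signedPower_one_add_isBigO (odd : Bool) (α : ℝ) (n : ℕ) :
    ∃ c : ℕ → ℝ, c 0 = 1 ∧
      (fun t => signedPower odd α (1 + t) - ∑ k ∈ Finset.range (n + 1), c k * t ^ k)
        =O[𝓝 0] fun t => ‖t‖ ^ (n + 1) := by
  have h := Real.one_add_rpow_hasFPowerSeriesAt_zero (a := α)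
  refine ⟨fun k => (binomialSeries ℝ α).coeff k, ?_, ?_⟩
  · change binomialSeries ℝ α 0 1 = 1
    rw [h.coeff_zero]
    simp
  · refine (h.isBigO_sub_partialSum_pow (n + 1)).congr' ?_ EventuallyEq.rfl
    filter_upwards [Ioi_mem_nhds (show (-1 : ℝ) < 0 by norm_num)] with t ht
    have ht' : 0 < 1 + t := by
      have : -1 < t := ht
      linarith
    rw [zero_add, signedPower_of_pos _ _ ht', FormalMultilinearSeries.partialSum]
    simp [mul_comm]

/-- For `α > m`, the power `s ^ α` outgrows every polynomial of degree at most `m`. -/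
lemma exists_ne_eval_of_lt {α : ℝ} {m : ℕ} (hα : (m : ℝ) < α) {p : Polynomial ℝ}
    (hp : p.degree < ((m + 1 : ℕ) : WithBot ℕ)) : ∃ s : ℝ, 0 < s ∧ s ^ α ≠ p.eval s := by
  by_contra! h
  have h1 : (fun s : ℝ => p.eval s) =O[atTop] fun s => s ^ m := by
    have := Polynomial.isBigO_atTop_of_degree_le p (Polynomial.X ^ m : Polynomial ℝ) (by
      rw [Polynomial.degree_X_pow]
      exact (Polynomial.degree_le_iff_coeff_zero p m).2 fun k hk =>
        (Polynomial.degree_lt_iff_coeff_zero p (m + 1)).1 hp k (by exact_mod_cast hk))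
    simpa using this
  have h2 : (fun s : ℝ => s ^ m) =o[atTop] fun s : ℝ => s ^ α := by
    refine isLittleO_of_tendsto' ?_ ?_
    · filter_upwards [eventually_gt_atTop (0 : ℝ)] with s hs h0
      exact absurd h0 (Real.rpow_pos_of_pos hs α).ne'
    · refine (tendsto_rpow_neg_atTop (sub_pos.2 hα)).congr' ?_
      filter_upwards [eventually_gt_atTop (0 : ℝ)] with s hs
      rw [neg_sub, Real.rpow_sub hs, Real.rpow_natCast]
  have h3 : (fun s : ℝ => s ^ α) =o[atTop] fun s : ℝ => s ^ α := by
    refine (IsBigO.congr' h1 ?_ EventuallyEq.rfl).trans_isLittleO h2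
    filter_upwards [eventually_gt_atTop (0 : ℝ)] with s hs using (h s hs).symm
  refine (isLittleO_irrefl ?_) h3
  refine Eventually.frequently ?_
  filter_upwards [eventually_gt_atTop (0 : ℝ)] with s hs using (Real.rpow_pos_of_pos hs α).ne'
end

/-! ### Failure of small powers: the graph part, and the critical exponents -/

section
variable {V : Type*}

lemma exists_mem_graphCone_submatrix_eq_gluedMatrix [Finite V] {G : SimpleGraph V} {r m : ℕ}
    (h : (completeMinusEdge r).IsContained G) (hm : m + 3 ≤ r) {δ : ℝ} (hδ : 0 ≤ δ)
    (x : Fin (m + 1) → ℝ) :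
    ∃ A ∈ graphCone G Set.univ, ((∀ i, 0 ≤ x i) → A ∈ graphCone G (Set.Ici 0)) ∧
      ∃ e : Fin 2 ⊕ Fin (m + 1) → V, A.submatrix e e = gluedMatrix δ x := by
  obtain ⟨φ⟩ := h
  let g : Fin 2 ⊕ Fin (m + 1) → Fin r :=
    Sum.elim (fun i => ⟨i, by omega⟩) fun i => ⟨i + 2, by omega⟩
  have hg : Function.Injective g := by
    rintro (i | i) (j | j) h <;> simp only [g, Sum.elim_inl, Sum.elim_inr, Fin.mk.injEq] at h
    · exact congrArg _ (Fin.ext h)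
    · omega
    · omega
    · exact congrArg _ (Fin.ext (by omega))
  let e : Fin 2 ⊕ Fin (m + 1) → V := fun p => φ (g p)
  have he : Function.Injective e := φ.injective.comp hg
  let U : Fin 2 ⊕ Fin (m + 1) → ℝ := Sum.elim ![1, 0] fun _ => 1
  let W : Fin 2 ⊕ Fin (m + 1) → ℝ := Sum.elim ![0, 1] fun i => δ * x i
  let A : Matrix V V ℝ :=
    Matrix.vecMulVec (Function.extend e U 0) (Function.extend e U 0) +
      Matrix.vecMulVec (Function.extend e W 0) (Function.extend e W 0)
  have hApos : A.PosSemidef := (posSemidef_vecMulVec_self _).add (posSemidef_vecMulVec_self _)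
  have hAsub : A.submatrix e e = gluedMatrix δ x := by
    ext p q
    simp [A, gluedMatrix, Matrix.vecMulVec_apply, he.extend_apply, U, W]
  have hzero : ∀ i j, i ≠ j → ¬ G.Adj i j → A i j = 0 := by
    intro i j hij hadj
    by_cases hi : ∃ p, e p = i
    swap
    · simp [A, Matrix.vecMulVec_apply, Function.extend_apply' _ _ _ hi]
    by_cases hj : ∃ q, e q = j
    swap
    · simp [A, Matrix.vecMulVec_apply, Function.extend_apply' _ _ _ hj]
    obtain ⟨p, rfl⟩ := hi
    obtain ⟨q, rfl⟩ := hj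
    have hne : g p ≠ g q := fun h => hij (congrArg φ h)
    have hsum : (g p : ℕ) + (g q : ℕ) = 1 := by
      by_contra hsum
      exact hadj (φ.toHom.map_adj ⟨hne, hsum⟩)
    rcases p with p | p <;> rcases q with q | q <;>
      simp only [g, Sum.elim_inl, Sum.elim_inr] at hsum
    · fin_cases p <;> fin_cases q <;> simp at hsum <;>
        simp [A, Matrix.vecMulVec_apply, he.extend_apply, U, W]
    all_goals omega
  refine ⟨A, ⟨hApos, fun _ _ => Set.mem_univ _, hzero⟩, fun hx => ⟨hApos, fun i j => ?_, hzero⟩,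
    e, hAsub⟩
  have hext : ∀ u : Fin 2 ⊕ Fin (m + 1) → ℝ, (∀ p, 0 ≤ u p) → ∀ i, 0 ≤ Function.extend e u 0 i := by
    intro u hu i
    by_cases hi : ∃ p, e p = i
    · obtain ⟨p, rfl⟩ := hi
      rw [he.extend_apply]
      exact hu p
    · rw [Function.extend_apply' _ _ _ hi]
      exact le_rfl
  have hU : ∀ p, 0 ≤ U p := by
    rintro (p | p)
    · fin_cases p <;> simp [U]
    · simp [U]
  have hW : ∀ p, 0 ≤ W p := by
    rintro (p | p)
    · fin_cases p <;> simp [W]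
    · exact mul_nonneg hδ (hx p)
  exact add_nonneg (mul_nonneg (hext U hU i) (hext U hU j)) (mul_nonneg (hext W hW i) (hext W hW j))

/-- A power `α < m + 1` fails on graphs containing `K_{m + 3}^{(1)}` if it is not reproduced by
interpolation at `0, …, m`. -/
theorem exists_mem_graphCone_not_posSemidef [Finite V] {G : SimpleGraph V} {r m : ℕ}
    (h : (completeMinusEdge r).IsContained G) (hm : m + 3 ≤ r) (odd : Bool) {α : ℝ}
    (hα : α < m + 1) {s : ℝ}
    (hs : signedPower odd α s ≠ (Lagrange.interpolate Finset.univ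
      (fun i : Fin (m + 1) => (i : ℝ)) fun i => signedPower odd α i).eval s) :
    ∃ A ∈ graphCone G Set.univ, (0 ≤ s → A ∈ graphCone G (Set.Ici 0)) ∧
      ¬ (A.map (signedPower odd α)).PosSemidef := by
  obtain ⟨x, y, hx, hxy, hT⟩ := exists_weights (signedPower_zero odd α) m hs
  obtain ⟨c, hc0, hc⟩ := exists_signedPower_one_add_isBigO odd α m
  obtain ⟨δ, hδ, hnot⟩ := exists_not_posSemidef_gluedMatrix (signedPower_zero odd α)
    (signedPower_one odd α) (signedPower_mul odd α) (fun t ht => signedPower_of_pos odd α ht) hα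
    hc0 hc hxy hT
  obtain ⟨A, hA, hAnn, e, he⟩ := exists_mem_graphCone_submatrix_eq_gluedMatrix h hm hδ x
  refine ⟨A, hA, fun hs0 => hAnn fun i => ?_, fun hpos => hnot ?_⟩
  · rcases hx i with h | h
    exacts [h ▸ hs0, h]
  · rw [← he]
    exact hpos.submatrix e

lemma map_mem_graphCone_iff {G : SimpleGraph V} {I : Set ℝ} {A : Matrix V V ℝ}
    (hA : A ∈ graphCone G I) {f : ℝ → ℝ} (hf : f 0 = 0) :
    A.map f ∈ graphCone G Set.univ ↔ (A.map f).PosSemidef :=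
  ⟨fun h => h.1, fun h => ⟨h, fun _ _ => Set.mem_univ _, fun i j hij hadj => by
    simp [hA.2.2 i j hij hadj, hf]⟩⟩

lemma posPower_zero (α : ℝ) : posPower α 0 = 0 := by simp [posPower]

lemma map_posPower_eq {G : SimpleGraph V} (odd : Bool) (α : ℝ) {A : Matrix V V ℝ}
    (hA : A ∈ graphCone G (Set.Ici 0)) : A.map (posPower α) = A.map (signedPower odd α) := by
  ext i j
  exact (signedPower_of_nonneg odd α (hA.2.1 i j)).symm

/-- The common form of `oddPowerSet` (for `odd = true`) and `evenPowerSet` (for `odd = false`). -/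
def signedPowerSet (odd : Bool) (G : SimpleGraph V) : Set ℝ :=
  {α | ∀ A ∈ graphCone G Set.univ, A.map (signedPower odd α) ∈ graphCone G Set.univ}

lemma signedPowerSet_subset_powerSet (odd : Bool) (G : SimpleGraph V) :
    signedPowerSet odd G ⊆ powerSet G := by
  intro α h A hA
  rw [map_posPower_eq odd α hA]
  exact h A ⟨hA.1, fun _ _ => Set.mem_univ _, hA.2.2⟩

lemma posSemidef_map_pow {A : Matrix V V ℝ} (hA : A.PosSemidef) {k : ℕ} (hk : 0 < k) :
    (A.map (· ^ k)).PosSemidef := by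
  induction k, hk using Nat.le_induction with
  | base => simpa using hA
  | succ k _ ih =>
    have h : A.map (· ^ (k + 1)) = (A.map (· ^ k)).hadamard A := by
      ext i j
      simp [pow_succ]
    rw [h]
    exact ih.hadamard hA

lemma natCast_mem_powerSet (G : SimpleGraph V) {k : ℕ} (hk : 0 < k) : (k : ℝ) ∈ powerSet G := by
  intro A hA
  rw [map_mem_graphCone_iff hA (posPower_zero _)]
  have h : A.map (posPower k) = A.map (· ^ k) := by
    ext i j
    by_cases h0 : A i j = 0
    · simp [posPower, h0, hk.ne']
    · simp [posPower, h0]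
  rw [h]
  exact posSemidef_map_pow hA.1 hk

lemma natCast_mem_signedPowerSet (odd : Bool) (G : SimpleGraph V) {k : ℕ} (hk : 0 < k)
    (hsign : paritySign odd = (-1) ^ k) : (k : ℝ) ∈ signedPowerSet odd G := by
  intro A hA
  rw [map_mem_graphCone_iff hA (signedPower_zero _ _)]
  have h : A.map (signedPower odd k) = A.map (· ^ k) := by
    ext i j
    rw [Matrix.map_apply, Matrix.map_apply]
    rcases lt_trichotomy (A i j) 0 with h0 | h0 | h0
    · rw [signedPower_of_neg _ _ h0, hsign, Real.rpow_natCast, ← mul_pow, neg_one_mul, neg_neg]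
    · simp [h0, hk.ne']
    · rw [signedPower_of_pos _ _ h0, Real.rpow_natCast]
  rw [h]
  exact posSemidef_map_pow hA.1 hk

lemma nonneg_of_mem_powerSet [Finite V] {G : SimpleGraph V} {u v : V} (huv : G.Adj u v) {α : ℝ}
    (hα : α ∈ powerSet G) : 0 ≤ α := by
  classical
  by_contra! hneg
  -- The block of `A` on `{u, v}` has diagonal entries `2` and off-diagonal entries `1`.
  let w : V → ℝ := fun i => if i = u ∨ i = v then 1 else 0
  have hw : ∀ i, 0 ≤ w i := fun i => by
    simp only [w]
    split_ifs <;> norm_num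
  let A : Matrix V V ℝ := Matrix.vecMulVec w w + Matrix.diagonal w
  have hA : A ∈ graphCone G (Set.Ici 0) := by
    refine ⟨(posSemidef_vecMulVec_self w).add (Matrix.PosSemidef.diagonal hw), fun i j => ?_,
      fun i j hij hadj => ?_⟩
    · refine add_nonneg (mul_nonneg (hw i) (hw j)) ?_
      rw [Matrix.diagonal_apply]
      split_ifs
      exacts [hw i, le_rfl]
    · have hor : w i = 0 ∨ w j = 0 := by
        by_contra! hcon
        simp only [w, ne_eq, ite_eq_right_iff, one_ne_zero, imp_false, not_not] at hcon
        rcases hcon with ⟨rfl | rfl, rfl | rfl⟩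
        exacts [hij rfl, hadj huv, hadj huv.symm, hij rfl]
      rcases hor with h | h <;> simp [A, Matrix.vecMulVec_apply, Matrix.diagonal_apply_ne _ hij, h]
  have h := (posSemidef_iff_sum_nonneg.1 ((hα A hA).1.submatrix ![u, v])).2 ![1, -1]
  have hlt : (2 : ℝ) ^ α < 1 := Real.rpow_lt_one_of_one_lt_of_neg (by norm_num) hneg
  have h2 : (1 : ℝ) + 1 = 2 := by norm_num
  simp [Fin.sum_univ_two, A, w, Matrix.vecMulVec_apply, Matrix.diagonal_apply, huv.ne, huv.ne',
    posPower, h2] at h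
  linarith

theorem eq_natCast_or_le_of_mem_powerSet [Finite V] {G : SimpleGraph V}
    (hedge : ∃ u v, G.Adj u v) {r : ℕ} (hr : (completeMinusEdge r).IsContained G) {α : ℝ}
    (hα : α ∈ powerSet G) : (∃ k : ℕ, 0 < k ∧ α = k) ∨ (r : ℝ) - 2 ≤ α := by
  obtain ⟨u, v, huv⟩ := hedge
  have hα0 := nonneg_of_mem_powerSet huv hα
  by_contra! hcon
  obtain ⟨hnat, hlt⟩ := hcon
  set m := ⌊α⌋₊ with hm
  have hmα : (m : ℝ) ≤ α := Nat.floor_le hα0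
  have hαm : α < m + 1 := Nat.lt_floor_add_one α
  have hmr : m + 3 ≤ r := by
    have : (m : ℝ) + 2 < r := by linarith
    have : m + 2 < r := by exact_mod_cast this
    omega
  have hs : ∃ s : ℝ, 0 ≤ s ∧ signedPower true α s ≠ (Lagrange.interpolate Finset.univ
      (fun i : Fin (m + 1) => (i : ℝ)) fun i => signedPower true α i).eval s := by
    rcases hmα.eq_or_lt with h | h
    · -- An exponent that is an integer can only be `0`, where the interpolant is constant.
      have hm0 : m = 0 := by
        by_contra h0
        exact hnat m (Nat.pos_of_ne_zero h0) h.symm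
      refine ⟨1, zero_le_one, ?_⟩
      have hz : (fun i : Fin (m + 1) => signedPower true α i) = 0 := by
        funext i
        have : (i : ℕ) = 0 := by omega
        simp [this]
      rw [hz, map_zero, Polynomial.eval_zero, signedPower_one]
      exact one_ne_zero
    · obtain ⟨s, hs, hne⟩ := exists_ne_eval_of_lt h
        (p := Lagrange.interpolate Finset.univ (fun i : Fin (m + 1) => (i : ℝ))
          fun i => signedPower true α i) (by
        have := Lagrange.degree_interpolate_lt (s := (Finset.univ : Finset (Fin (m + 1))))
          (v := fun i => (i : ℝ)) (fun i => signedPower true α i)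
          (fun i _ j _ h => by simpa [Fin.ext_iff] using h)
        rwa [Finset.card_univ, Fintype.card_fin] at this)
      exact ⟨s, hs.le, by rwa [signedPower_of_pos _ _ hs]⟩
  obtain ⟨s, hs0, hs⟩ := hs
  obtain ⟨A, -, hA, hnot⟩ := exists_mem_graphCone_not_posSemidef hr hmr true hαm hs
  refine hnot ?_
  rw [← map_posPower_eq true α (hA hs0)]
  exact (hα A (hA hs0)).1

/-- Integer powers of the wrong parity fail below `r - 2`: at `s = -1` they differ from the
interpolant `t ^ k`. -/
theorem le_of_natCast_mem_signedPowerSet [Finite V] {G : SimpleGraph V} {r : ℕ}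
    (hr : (completeMinusEdge r).IsContained G) (odd : Bool) {k : ℕ} (hk : 0 < k)
    (hsign : paritySign odd ≠ (-1) ^ k) (h : (k : ℝ) ∈ signedPowerSet odd G) :
    (r : ℝ) - 2 ≤ k := by
  by_contra! hlt
  have hkr : k + 3 ≤ r := by
    have : (k : ℝ) + 2 < r := by linarith
    have : k + 2 < r := by exact_mod_cast this
    omega
  have hinterp : (Lagrange.interpolate Finset.univ (fun i : Fin (k + 1) => (i : ℝ))
      fun i => signedPower odd k i) = Polynomial.X ^ k := by
    symm
    refine Lagrange.eq_interpolate_of_eval_eq _ (fun i _ j _ h => by simpa [Fin.ext_iff] using h)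
      ?_ fun i _ => ?_
    · rw [Polynomial.degree_X_pow, Finset.card_univ, Fintype.card_fin]
      exact_mod_cast Nat.lt_succ_self k
    · rw [Polynomial.eval_pow, Polynomial.eval_X]
      rcases (Nat.cast_nonneg (α := ℝ) (i : ℕ)).eq_or_lt with h0 | h0
      · simp [← h0, hk.ne']
      · rw [signedPower_of_pos _ _ h0, Real.rpow_natCast]
  obtain ⟨A, hA, -, hnot⟩ := exists_mem_graphCone_not_posSemidef hr hkr odd (α := k)
    (by linarith) (s := -1) (by
      rw [hinterp, Polynomial.eval_pow, Polynomial.eval_X, signedPower_of_neg _ _ (by norm_num)]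
      simpa using hsign)
  exact hnot (h A hA).1

theorem SimpleGraph.IsChordal.mem_signedPowerSet [Fintype V] {G : SimpleGraph V}
    (hG : G.IsChordal) {r : ℕ} (hr : ∀ k, (completeMinusEdge k).IsContained G → k ≤ r)
    (odd : Bool) {α : ℝ} (hα0 : 0 ≤ α) (hα : (r : ℝ) - 2 ≤ α) : α ∈ signedPowerSet odd G := by
  intro A hA
  rw [map_mem_graphCone_iff hA (signedPower_zero _ _)]
  exact hG.posSemidef_map_signedPower hr odd hα0 hα Finset.univ A hA.1
    (fun i hi => absurd (Finset.mem_univ i) hi) hA.2.2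

lemma isLeast_of_subset_natCast_union_Ici {T : Set ℝ} {c : ℝ} (h1 : Set.Ici c ⊆ T)
    (h2 : ∀ α ∈ T, (∃ k : ℕ, 0 < k ∧ α = k) ∨ c ≤ α) :
    IsLeast {α : ℝ | ∀ β, α ≤ β → β ∈ T} c := by
  refine ⟨fun β hβ => h1 hβ, fun α hα => ?_⟩
  by_contra! hlt
  obtain ⟨β, hirr, hαβ, hβc⟩ := exists_irrational_btwn hlt
  rcases h2 β (hα β hαβ.le) with ⟨k, -, hk⟩ | h
  · exact hirr.ne_nat k hk
  · exact h.not_gt hβc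
end

theorem theorem1p3 {V : Type*} [Fintype V] (G : SimpleGraph V)
    (hV : 2 ≤ Fintype.card V) (hchordal : G.IsChordal) (hedge : ∃ u v, G.Adj u v)
    (r : ℕ) (hr : IsGreatest {k : ℕ | (completeMinusEdge k).IsContained G} r) :
    powerSet G = {α : ℝ | ∃ k : ℕ, 0 < k ∧ α = k} ∪ Set.Ici ((r : ℝ) - 2) ∧
    oddPowerSet G = {α : ℝ | ∃ k : ℕ, 0 < k ∧ α = -1 + 2 * k} ∪ Set.Ici ((r : ℝ) - 2) ∧
    evenPowerSet G = {α : ℝ | ∃ k : ℕ, 0 < k ∧ α = 2 * k} ∪ Set.Ici ((r : ℝ) - 2) ∧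
    IsCriticalExponent G ((r : ℝ) - 2) ∧
    IsOddCriticalExponent G ((r : ℝ) - 2) ∧
    IsEvenCriticalExponent G ((r : ℝ) - 2) := by
  obtain ⟨hcont, hmax⟩ := hr
  have hcont' : (completeMinusEdge r).IsContained G := hcont
  have hub : ∀ k, (completeMinusEdge k).IsContained G → k ≤ r := fun k hk => hmax hk
  have hr2 : (2 : ℝ) ≤ r := by
    have h2 : (completeMinusEdge 2).IsContained G := by
      have hbot : completeMinusEdge 2 = ⊥ := by
        ext i j
        fin_cases i <;> fin_cases j <;> simp [completeMinusEdge]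
      rw [hbot, SimpleGraph.bot_isContained_iff_card_le]
      simpa using hV
    exact_mod_cast hub 2 h2
  have hsigned : ∀ odd, Set.Ici ((r : ℝ) - 2) ⊆ signedPowerSet odd G := fun odd α hα =>
    hchordal.mem_signedPowerSet hub odd (le_trans (by linarith) (Set.mem_Ici.1 hα)) hα
  have hpower : Set.Ici ((r : ℝ) - 2) ⊆ powerSet G :=
    (hsigned true).trans (signedPowerSet_subset_powerSet true G)
  have hnec : ∀ α ∈ powerSet G, (∃ k : ℕ, 0 < k ∧ α = k) ∨ (r : ℝ) - 2 ≤ α :=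
    fun α hα => eq_natCast_or_le_of_mem_powerSet hedge hcont' hα
  have hnec' : ∀ odd, ∀ α ∈ signedPowerSet odd G, (∃ k : ℕ, 0 < k ∧ α = k) ∨ (r : ℝ) - 2 ≤ α :=
    fun odd α hα => hnec α (signedPowerSet_subset_powerSet odd G hα)
  have hleast := isLeast_of_subset_natCast_union_Ici hpower hnec
  have hleast' := fun odd => isLeast_of_subset_natCast_union_Ici (hsigned odd) (hnec' odd)
  refine ⟨Set.Subset.antisymm (fun α hα => hnec α hα) ?_, Set.Subset.antisymm ?_ ?_,
    Set.Subset.antisymm ?_ ?_, ?_, ?_, ?_⟩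
  · rintro α (⟨k, hk, rfl⟩ | hα)
    exacts [natCast_mem_powerSet G hk, hpower hα]
  · intro α hα
    rcases hnec' true α hα with ⟨k, hk, rfl⟩ | h
    · rcases Nat.even_or_odd k with hpar | ⟨l, rfl⟩
      · refine Or.inr (le_of_natCast_mem_signedPowerSet hcont' true hk ?_ hα)
        rw [hpar.neg_one_pow]
        norm_num [paritySign]
      · exact Or.inl ⟨l + 1, l.succ_pos, by push_cast; ring⟩
    · exact Or.inr h
  · rintro α (⟨k, hk, rfl⟩ | hα)
    · obtain ⟨l, rfl⟩ := Nat.exists_eq_add_of_lt hk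
      have h := natCast_mem_signedPowerSet true G (k := 2 * l + 1) (by omega)
        (by rw [pow_succ, pow_mul]; norm_num [paritySign])
      have hval : (-1 + 2 * ((0 + l + 1 : ℕ) : ℝ)) = ((2 * l + 1 : ℕ) : ℝ) := by
        push_cast
        ring
      rw [hval]
      exact h
    · exact hsigned true hα
  · intro α hα
    rcases hnec' false α hα with ⟨k, hk, rfl⟩ | h
    · rcases Nat.even_or_odd' k with ⟨l, rfl | rfl⟩
      · exact Or.inl ⟨l, by omega, by push_cast; ring⟩
      · refine Or.inr (le_of_natCast_mem_signedPowerSet hcont' false hk ?_ hα)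
        rw [pow_succ, pow_mul]
        norm_num [paritySign]
    · exact Or.inr h
  · rintro α (⟨k, hk, rfl⟩ | hα)
    · have h := natCast_mem_signedPowerSet false G (k := 2 * k) (by omega)
        (by rw [pow_mul]; norm_num [paritySign])
      push_cast at h
      exact h
    · exact hsigned false hα
  · exact ⟨fun A hA β hβ => hleast.1 β hβ A hA, fun α hα => hleast.2 fun β hβ A hA => hα A hA β hβ⟩
  · exact ⟨fun A hA β hβ => (hleast' true).1 β hβ A hA,
      fun α hα => (hleast' true).2 fun β hβ A hA => hα A hA β hβ⟩
  · exact ⟨fun A hA β hβ => (hleast' false).1 β hβ A hA,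
      fun α hα => (hleast' false).2 fun β hβ A hA => hα A hA β hβ⟩
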